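/- **Theorem 4.4.** Finite types are generated from the type $0$ of natural numbers by $\sigma\to\tau$ and $\sigma^{*}$ (finite sequences of objects of type $\sigma$); $1$ is $0\to 0$ and $2$ is $1\to 0$. Let $\mathsf{E\text{-}PA}^{\omega*}$ be classical Peano arithmetic in all these types, with constants for zero, successor, the combinators, the recursors, the empty sequence, the operation $\langle a\rangle * x$ and recursion over sequences, with induction for all its formulas and the axiom of extensionality $x=_{\rho}y\rightarrow\varphi(x)=_{\tau}\varphi(y)$; only $=_0$ is primitive, and equality at higher types is defined extensionally. Add a predicate $\mathrm{st}$ at every type, write $(\forall^{\mathrm{st}}x)$ and $(\exists^{\mathrm{st}}x)$ for the quantifiers over $x$ with $\mathrm{st}(x)$, and call a formula internal if $\mathrm{st}$ does not occur in it. The system $\mathsf{P}$ consists of $\mathsf{E\text{-}PA}^{\omega*}$ and the following axioms: * $\mathrm{st}(x)\wedge x=y\rightarrow \mathrm{st}(y)$; $\mathrm{st}(t)$ for every closed term $t$; $\mathrm{st}(f)\wedge\mathrm{st}(x)\rightarrow\mathrm{st}(f(x))$; * $\Phi(0)\wedge(\forall^{\mathrm{st}}n^{0})(\Phi(n)\rightarrow\Phi(n+1))\rightarrow(\forall^{\mathrm{st}}n^{0})\Phi(n)$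 for every formula $\Phi$; * $(\forall^{\mathrm{st}}x^{\rho})(\exists^{\mathrm{st}}y^{\tau})\varphi(x,y)\rightarrow(\exists^{\mathrm{st}}F^{\rho\to\tau^{*}})(\forall^{\mathrm{st}}x^{\rho})(\exists y^{\tau}\in F(x))\varphi(x,y)$ for internal $\varphi$; * $(\forall^{\mathrm{st}}x^{\sigma^{*}})(\exists y^{\tau})(\forall z^{\sigma}\in x)\varphi(z,y)\rightarrow(\exists y^{\tau})(\forall^{\mathrm{st}}x^{\sigma})\varphi(x,y)$ for internal $\varphi$. For $\alpha$ of type $1$, write $\alpha\leq_1 1$ if $\alpha(n)\leq 1$ for all $n$, let $\overline{\alpha}n=\langle\alpha(0),\dots,\alpha(n-1)\rangle$, and let $\alpha\approx_1\beta$ stand for $(\forall^{\mathrm{st}}n^{0})(\alpha(n)=\beta(n))$. Finite sequences of numbers are coded by numbers, and "$T^{1}\leq_1 1$ is a binary tree" means that $T$ is the characteristic function of a set of finite binary sequences closed under initial segments; in the formulas below $(\forall T^{1}\leq_1 1)$ ranges over binary trees. The principle $\mathsf{STP}$ is $$(\forall\alpha^{1}\leq_1 1)(\exists^{\mathrm{st}}\beta^{1}\leq_1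 1)(\alpha\approx_1\beta).$$ (a) $\mathsf{P}$ proves that $\mathsf{STP}$ is equivalent to the normal form $$(\forall^{\mathrm{st}}g^{2})(\exists^{\mathrm{st}}w^{1^{*}})(\forall T^{1}\leq_1 1)(\exists(\alpha^{1}\leq_1 1,k^{0})\in w)\big[\overline{\alpha}g(\alpha)\notin T\rightarrow(\forall\beta^{1}\leq_1 1)(\exists i\leq k)(\overline{\beta}i\notin T)\big],$$ where the pair $(\alpha,k)$ is coded as the type $1$ object $\gamma$ with $\gamma(0)=k$ and $\gamma(n+1)=\alpha(n)$. (b) For a pair $\Theta=(\Theta_1^{2\to 0},\Theta_2^{2\to 1^{*}})$ let $\mathsf{SCF}(\Theta)$ be $$(\forall g^{2})(\forall T^{1}\leq_1 1)\big[(\forall\alpha\in\Theta_2(g))(\overline{\alpha}g(\alpha)\notin T)\rightarrow(\forall\beta^{1}\leq_1 1)(\exists i\leq\Theta_1(g))(\overline{\beta}i\notin T)\big].$$ Then $\mathsf{P}+(\exists^{\mathrm{st}}\Theta)\mathsf{SCF}(\Theta)$ proves $\mathsf{STP}$, where $(\exists^{\mathrm{st}}\Theta)$ means that both $\Theta_1$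 and $\Theta_2$ are standard. -/

import Mathlib

/-! Classical nonstandard arithmetic in all finite types: the language, a natural deduction
calculus, the system `P`, and the sentences that the theorem is about. -/

namespace NSArith

/-- Finite types: numbers, functions, and finite sequences `σ*`. -/
inductive Ty : Type
  | zero : Ty
  | arr : Ty → Ty → Ty
  | seq : Ty → Ty

infixr:60 " ⇒ " => Ty.arr

/-- The type `1` of functions from numbers to numbers. -/
abbrev Ty.one : Ty := Ty.zero ⇒ Ty.zero

/-- The type `2` of functionals from type `1` to numbers. -/
abbrev Ty.two : Ty := Ty.one ⇒ Ty.zero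

open Ty

/-- A context lists the types of the free variables, most recently bound first. -/
abbrev Ctx : Type := List Ty

/-- Typed de Bruijn variables. -/
inductive Var : Ctx → Ty → Type
  | here {Γ : Ctx} {σ : Ty} : Var (σ :: Γ) σ
  | there {Γ : Ctx} {σ τ : Ty} : Var Γ σ → Var (τ :: Γ) σ

/-- The constants: zero, successor, the two combinators, the recursors, the empty sequence,
the operation that prepends an element to a sequence, and the sequence recursors. -/
inductive Con : Ty → Type
  | zero : Con Ty.zero
  | succ : Con (Ty.zero ⇒ Ty.zero)
  | comK (σ τ : Ty) : Con (σ ⇒ τ ⇒ σ)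
  | comS (ρ σ τ : Ty) : Con ((ρ ⇒ σ ⇒ τ) ⇒ (ρ ⇒ σ) ⇒ ρ ⇒ τ)
  | recN (ρ : Ty) : Con (Ty.zero ⇒ ρ ⇒ (ρ ⇒ Ty.zero ⇒ ρ) ⇒ ρ)
  | nil (σ : Ty) : Con (seq σ)
  | cons (σ : Ty) : Con (σ ⇒ seq σ ⇒ seq σ)
  | recL (σ ρ : Ty) : Con (seq σ ⇒ ρ ⇒ (ρ ⇒ σ ⇒ ρ) ⇒ ρ)

/-- Terms of a given type in a given context. -/
inductive Tm : Ctx → Ty → Type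
  | var {Γ : Ctx} {σ : Ty} : Var Γ σ → Tm Γ σ
  | con {Γ : Ctx} {σ : Ty} : Con σ → Tm Γ σ
  | app {Γ : Ctx} {σ τ : Ty} : Tm Γ (σ ⇒ τ) → Tm Γ σ → Tm Γ τ

infixl:80 " ⊙ " => Tm.app

/-- Renamings and substitutions. -/
abbrev Ren (Γ Δ : Ctx) : Type := ∀ σ : Ty, Var Γ σ → Var Δ σ
abbrev Sub (Γ Δ : Ctx) : Type := ∀ σ : Ty, Var Γ σ → Tm Δ σ

/-- Extension of a renaming under a binder. -/
def Ren.lift {Γ Δ : Ctx} {τ : Ty} (r : Ren Γ Δ) : Ren (τ :: Γ) (τ :: Δ)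
  | _, Var.here => Var.here
  | _, Var.there v => Var.there (r _ v)

/-- The renaming that adds one fresh variable. -/
def Ren.wk {Γ : Ctx} {τ : Ty} : Ren Γ (τ :: Γ) := fun _ v => Var.there v

/-- The renaming out of the empty context. -/
def Ren.empty {Γ : Ctx} : Ren [] Γ := fun _ v => nomatch v

def Tm.rename {Γ Δ : Ctx} (r : Ren Γ Δ) : {σ : Ty} → Tm Γ σ → Tm Δ σ
  | _, Tm.var v => Tm.var (r _ v)
  | _, Tm.con c => Tm.con c
  | _, Tm.app f a => Tm.app (f.rename r) (a.rename r)

def Tm.subst {Γ Δ : Ctx} (s : Sub Γ Δ) : {σ : Ty} → Tm Γ σ → Tm Δ σ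
  | _, Tm.var v => s _ v
  | _, Tm.con c => Tm.con c
  | _, Tm.app f a => Tm.app (f.subst s) (a.subst s)

/-- Weakening of a term by one fresh variable. -/
def Tm.wk {Γ : Ctx} {σ τ : Ty} (t : Tm Γ σ) : Tm (τ :: Γ) σ := t.rename Ren.wk

/-- A closed term, seen in an arbitrary context. -/
def Tm.up {Γ : Ctx} {σ : Ty} (t : Tm [] σ) : Tm Γ σ := t.rename Ren.empty

def Sub.lift {Γ Δ : Ctx} {τ : Ty} (s : Sub Γ Δ) : Sub (τ :: Γ) (τ :: Δ)
  | _, Var.here => Tm.var Var.here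
  | _, Var.there v => (s _ v).wk

/-- The substitution of one term for the most recent variable. -/
def Sub.inst {Γ : Ctx} {τ : Ty} (t : Tm Γ τ) : Sub (τ :: Γ) Γ
  | _, Var.here => t
  | _, Var.there v => Tm.var v

/-- The substitution `n ↦ n + 1` in the most recent variable `n` of type `0`. -/
def Sub.succ {Γ : Ctx} : Sub (Ty.zero :: Γ) (Ty.zero :: Γ)
  | _, Var.here => Tm.con Con.succ ⊙ Tm.var Var.here
  | _, Var.there v => Tm.var (Var.there v)

/-- The most recent variables. -/
abbrev v0 {Γ : Ctx} {a : Ty} : Tm (a :: Γ) a := Tm.var Var.here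
abbrev v1 {Γ : Ctx} {a b : Ty} : Tm (a :: b :: Γ) b := Tm.var (Var.there Var.here)
abbrev v2 {Γ : Ctx} {a b c : Ty} : Tm (a :: b :: c :: Γ) c :=
  Tm.var (Var.there (Var.there Var.here))
abbrev v3 {Γ : Ctx} {a b c d : Ty} : Tm (a :: b :: c :: d :: Γ) d :=
  Tm.var (Var.there (Var.there (Var.there Var.here)))
abbrev v4 {Γ : Ctx} {a b c d e : Ty} : Tm (a :: b :: c :: d :: e :: Γ) e :=
  Tm.var (Var.there (Var.there (Var.there (Var.there Var.here))))

/-- Abstraction of the most recent variable, defined through the combinators. -/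
def Tm.lam {Γ : Ctx} {σ : Ty} : {τ : Ty} → Tm (σ :: Γ) τ → Tm Γ (σ ⇒ τ)
  | _, Tm.var Var.here =>
      Tm.con (Con.comS σ (σ ⇒ σ) σ) ⊙ Tm.con (Con.comK σ (σ ⇒ σ)) ⊙ Tm.con (Con.comK σ σ)
  | _, Tm.var (Var.there v) => Tm.con (Con.comK _ σ) ⊙ Tm.var v
  | _, Tm.con c => Tm.con (Con.comK _ σ) ⊙ Tm.con c
  | _, Tm.app f a => Tm.con (Con.comS σ _ _) ⊙ f.lam ⊙ a.lam

/-! ### Some closed terms -/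

/-- The number zero and the successor of a term. -/
def Tm.zer {Γ : Ctx} : Tm Γ Ty.zero := Tm.con Con.zero
def Tm.suc {Γ : Ctx} (t : Tm Γ Ty.zero) : Tm Γ Ty.zero := Tm.con Con.succ ⊙ t

/-- The empty sequence, and the sequence `⟨a⟩ * x`. -/
def Tm.nil {Γ : Ctx} {σ : Ty} : Tm Γ (seq σ) := Tm.con (Con.nil σ)
def Tm.cons {Γ : Ctx} {σ : Ty} (a : Tm Γ σ) (x : Tm Γ (seq σ)) : Tm Γ (seq σ) :=
  Tm.con (Con.cons σ) ⊙ a ⊙ x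

/-- A closed term of each type (the value of `(x)_i` when `i` is at least the length of `x`). -/
def dflt : (σ : Ty) → Tm [] σ
  | Ty.zero => Tm.zer
  | Ty.arr σ τ => Tm.con (Con.comK τ σ) ⊙ dflt τ
  | Ty.seq _ => Tm.nil

/-- Addition: `m + 0 = m`, `m + S n = S (m + n)`. -/
def addC : Tm [] (Ty.zero ⇒ Ty.zero ⇒ Ty.zero) :=
  Tm.lam (Tm.lam (Tm.con (Con.recN Ty.zero) ⊙ v0 ⊙ v1 ⊙ Tm.lam (Tm.lam (Tm.suc v1))))

def Tm.add {Γ : Ctx} (m n : Tm Γ Ty.zero) : Tm Γ Ty.zero := addC.up ⊙ m ⊙ n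

/-- Multiplication: `m * 0 = 0`, `m * S n = m * n + m`. -/
def mulC : Tm [] (Ty.zero ⇒ Ty.zero ⇒ Ty.zero) :=
  Tm.lam (Tm.lam (Tm.con (Con.recN Ty.zero) ⊙ v0 ⊙ Tm.zer ⊙ Tm.lam (Tm.lam (Tm.add v1 v3))))

def Tm.mul {Γ : Ctx} (m n : Tm Γ Ty.zero) : Tm Γ Ty.zero := mulC.up ⊙ m ⊙ n

/-- Length of a sequence: `|⟨⟩| = 0`, `|⟨a⟩ * x| = S |x|`. -/
def lenC (σ : Ty) : Tm [] (seq σ ⇒ Ty.zero) :=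
  Tm.lam (Tm.con (Con.recL σ Ty.zero) ⊙ v0 ⊙ Tm.zer ⊙ Tm.lam (Tm.lam (Tm.suc v1)))

def Tm.len {Γ : Ctx} {σ : Ty} (x : Tm Γ (seq σ)) : Tm Γ Ty.zero := (lenC σ).up ⊙ x

/-- Entries of a sequence: `(⟨a⟩ * x)_0 = a`, `(⟨a⟩ * x)_(S i) = (x)_i`. -/
def nthC (σ : Ty) : Tm [] (seq σ ⇒ Ty.zero ⇒ σ) :=
  Tm.lam (Tm.con (Con.recL σ (Ty.zero ⇒ σ)) ⊙ v0 ⊙ Tm.lam (dflt σ).up ⊙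
    Tm.lam (Tm.lam (Tm.lam (Tm.con (Con.recN σ) ⊙ v0 ⊙ v1 ⊙ Tm.lam (Tm.lam (v4 ⊙ v0))))))

def Tm.nth {Γ : Ctx} {σ : Ty} (x : Tm Γ (seq σ)) (i : Tm Γ Ty.zero) : Tm Γ σ :=
  (nthC σ).up ⊙ x ⊙ i

/-- Concatenation: `⟨⟩ * y = y`, `(⟨a⟩ * x) * y = ⟨a⟩ * (x * y)`. -/
def catC (σ : Ty) : Tm [] (seq σ ⇒ seq σ ⇒ seq σ) :=
  Tm.lam (Tm.lam (Tm.con (Con.recL σ (seq σ)) ⊙ v1 ⊙ v0 ⊙ Tm.lam (Tm.lam (Tm.cons v0 v1))))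

def Tm.cat {Γ : Ctx} {σ : Ty} (x y : Tm Γ (seq σ)) : Tm Γ (seq σ) := (catC σ).up ⊙ x ⊙ y

/-- The initial segment `⟨α 0, …, α (n - 1)⟩` of a type `1` object. -/
def barC : Tm [] (Ty.one ⇒ Ty.zero ⇒ seq Ty.zero) :=
  Tm.lam (Tm.lam (Tm.con (Con.recN (seq Ty.zero)) ⊙ v0 ⊙ Tm.nil ⊙
    Tm.lam (Tm.lam (Tm.cat v1 (Tm.cons (v3 ⊙ v0) Tm.nil)))))

def Tm.bar {Γ : Ctx} (α : Tm Γ Ty.one) (n : Tm Γ Ty.zero) : Tm Γ (seq Ty.zero) :=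
  barC.up ⊙ α ⊙ n

/-- An injective coding of finite number sequences by numbers:
`#⟨⟩ = 0`, `#(⟨a⟩ * x) = S ((a + #x) * (a + #x) + a)`. -/
def codeC : Tm [] (seq Ty.zero ⇒ Ty.zero) :=
  Tm.lam (Tm.con (Con.recL Ty.zero Ty.zero) ⊙ v0 ⊙ Tm.zer ⊙
    Tm.lam (Tm.lam (Tm.suc (Tm.add (Tm.mul (Tm.add v0 v1) (Tm.add v0 v1)) v0))))

def Tm.code {Γ : Ctx} (x : Tm Γ (seq Ty.zero)) : Tm Γ Ty.zero := codeC.up ⊙ x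

/-! ### Formulas -/

/-- Formulas. The logic is classical; the other connectives are defined below. Equality is
primitive only between numbers, and there is a standardness predicate at each type. -/
inductive Fm : Ctx → Type
  | bot {Γ : Ctx} : Fm Γ
  | eqN {Γ : Ctx} : Tm Γ Ty.zero → Tm Γ Ty.zero → Fm Γ
  | st {Γ : Ctx} {σ : Ty} : Tm Γ σ → Fm Γ
  | imp {Γ : Ctx} : Fm Γ → Fm Γ → Fm Γ
  | all {Γ : Ctx} (σ : Ty) : Fm (σ :: Γ) → Fm Γ

abbrev Sentence : Type := Fm []

namespace Fm

/-- A formula is internal if the standardness predicate does not occur in it. -/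
def Internal : {Γ : Ctx} → Fm Γ → Prop
  | _, bot => True
  | _, eqN _ _ => True
  | _, st _ => False
  | _, imp φ ψ => φ.Internal ∧ ψ.Internal
  | _, all _ φ => φ.Internal

def rename : {Γ Δ : Ctx} → Ren Γ Δ → Fm Γ → Fm Δ
  | _, _, _, bot => bot
  | _, _, r, eqN t u => eqN (t.rename r) (u.rename r)
  | _, _, r, st t => st (t.rename r)
  | _, _, r, imp φ ψ => imp (φ.rename r) (ψ.rename r)
  | _, _, r, all σ φ => all σ (φ.rename r.lift)

def subst : {Γ Δ : Ctx} → Sub Γ Δ → Fm Γ → Fm Δ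
  | _, _, _, bot => bot
  | _, _, s, eqN t u => eqN (t.subst s) (u.subst s)
  | _, _, s, st t => st (t.subst s)
  | _, _, s, imp φ ψ => imp (φ.subst s) (ψ.subst s)
  | _, _, s, all σ φ => all σ (φ.subst s.lift)

variable {Γ : Ctx}

def neg (φ : Fm Γ) : Fm Γ := imp φ bot
def and (φ ψ : Fm Γ) : Fm Γ := neg (imp φ (neg ψ))
def or (φ ψ : Fm Γ) : Fm Γ := imp (neg φ) ψ
def iff (φ ψ : Fm Γ) : Fm Γ := and (imp φ ψ) (imp ψ φ)
def ex (σ : Ty) (φ : Fm (σ :: Γ)) : Fm Γ := neg (all σ (neg φ))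

/-- The quantifiers over standard objects. -/
def allSt (σ : Ty) (φ : Fm (σ :: Γ)) : Fm Γ := all σ (imp (st v0) φ)
def exSt (σ : Ty) (φ : Fm (σ :: Γ)) : Fm Γ := ex σ (and (st v0) φ)

/-- `m ≤ n` and `m < n` for numbers. -/
def le (m n : Tm Γ Ty.zero) : Fm Γ := ex Ty.zero (eqN (Tm.add m.wk v0) n.wk)
def lt (m n : Tm Γ Ty.zero) : Fm Γ := le m.suc n

/-- Extensional equality at every type: pointwise for functions, equal lengths and equal
entries for sequences. -/
def eq : {Γ : Ctx} → (σ : Ty) → Tm Γ σ → Tm Γ σ → Fm Γ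
  | _, Ty.zero, x, y => eqN x y
  | _, Ty.arr σ τ, x, y => all σ (eq τ (x.wk ⊙ v0) (y.wk ⊙ v0))
  | _, Ty.seq σ, x, y =>
      and (eqN x.len y.len)
        (all Ty.zero (imp (lt v0 x.wk.len) (eq σ (x.wk.nth v0) (y.wk.nth v0))))

/-- `a ∈ x`, for a finite sequence `x`: some entry of `x` equals `a`. -/
def mem {σ : Ty} (a : Tm Γ σ) (x : Tm Γ (seq σ)) : Fm Γ :=
  ex Ty.zero (and (lt v0 x.wk.len) (eq σ a.wk (x.wk.nth v0)))

/-- Universal closure. -/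
def close : {Γ : Ctx} → Fm Γ → Sentence
  | [], φ => φ
  | σ :: _, φ => close (all σ φ)

end Fm

open Fm

/-! ### Derivations -/

/-- Classical natural deduction. `Prf T Δ φ` says that `φ` is derivable from the sentences
in `T` and the assumptions in `Δ`. -/
inductive Prf (T : Set Sentence) : {Γ : Ctx} → List (Fm Γ) → Fm Γ → Prop
  | ax {Γ : Ctx} {Δ : List (Fm Γ)} {φ : Sentence} : φ ∈ T → Prf T Δ (φ.rename Ren.empty)
  | hyp {Γ : Ctx} {Δ : List (Fm Γ)} {φ : Fm Γ} : φ ∈ Δ → Prf T Δ φ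
  | impI {Γ : Ctx} {Δ : List (Fm Γ)} {φ ψ : Fm Γ} : Prf T (φ :: Δ) ψ → Prf T Δ (imp φ ψ)
  | impE {Γ : Ctx} {Δ : List (Fm Γ)} {φ ψ : Fm Γ} :
      Prf T Δ (imp φ ψ) → Prf T Δ φ → Prf T Δ ψ
  | raa {Γ : Ctx} {Δ : List (Fm Γ)} {φ : Fm Γ} : Prf T (neg φ :: Δ) bot → Prf T Δ φ
  | allI {Γ : Ctx} {Δ : List (Fm Γ)} {σ : Ty} {φ : Fm (σ :: Γ)} :
      Prf T (Δ.map (Fm.rename Ren.wk)) φ → Prf T Δ (all σ φ)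
  | allE {Γ : Ctx} {Δ : List (Fm Γ)} {σ : Ty} {φ : Fm (σ :: Γ)} (t : Tm Γ σ) :
      Prf T Δ (all σ φ) → Prf T Δ (φ.subst (Sub.inst t))

/-- A theory proves a sentence. -/
def Proves (T : Set Sentence) (φ : Sentence) : Prop := Prf T [] φ

/-! ### The system `P` -/

/-- The axioms of Peano arithmetic in all finite types with finite sequence types and full
extensionality, as open formulas. -/
inductive AxEPA : {Γ : Ctx} → Fm Γ → Prop
  /- equality between numbers -/
  | eq_refl {Γ : Ctx} (x : Tm Γ Ty.zero) : AxEPA (eqN x x)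
  | eq_symm {Γ : Ctx} (x y : Tm Γ Ty.zero) : AxEPA (imp (eqN x y) (eqN y x))
  | eq_trans {Γ : Ctx} (x y z : Tm Γ Ty.zero) :
      AxEPA (imp (eqN x y) (imp (eqN y z) (eqN x z)))
  /- extensionality -/
  | ext {Γ : Ctx} (ρ τ : Ty) (x y : Tm Γ ρ) (f : Tm Γ (ρ ⇒ τ)) :
      AxEPA (imp (eq ρ x y) (eq τ (f ⊙ x) (f ⊙ y)))
  /- successor -/
  | succ_ne_zero {Γ : Ctx} (x : Tm Γ Ty.zero) : AxEPA (neg (eqN x.suc Tm.zer))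
  | succ_inj {Γ : Ctx} (x y : Tm Γ Ty.zero) : AxEPA (imp (eqN x.suc y.suc) (eqN x y))
  /- induction for internal formulas -/
  | induction {Γ : Ctx} (φ : Fm (Ty.zero :: Γ)) : φ.Internal →
      AxEPA (imp (and (φ.subst (Sub.inst Tm.zer))
        (all Ty.zero (imp φ (φ.subst Sub.succ)))) (all Ty.zero φ))
  /- combinators -/
  | comK {Γ : Ctx} (σ τ : Ty) (x : Tm Γ σ) (y : Tm Γ τ) :
      AxEPA (eq σ (Tm.con (Con.comK σ τ) ⊙ x ⊙ y) x)
  | comS {Γ : Ctx} (ρ σ τ : Ty) (x : Tm Γ (ρ ⇒ σ ⇒ τ)) (y : Tm Γ (ρ ⇒ σ)) (z : Tm Γ ρ) :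
      AxEPA (eq τ (Tm.con (Con.comS ρ σ τ) ⊙ x ⊙ y ⊙ z) (x ⊙ z ⊙ (y ⊙ z)))
  /- recursors -/
  | rec_zero {Γ : Ctx} (ρ : Ty) (y : Tm Γ ρ) (z : Tm Γ (ρ ⇒ Ty.zero ⇒ ρ)) :
      AxEPA (eq ρ (Tm.con (Con.recN ρ) ⊙ Tm.zer ⊙ y ⊙ z) y)
  | rec_succ {Γ : Ctx} (ρ : Ty) (n : Tm Γ Ty.zero) (y : Tm Γ ρ) (z : Tm Γ (ρ ⇒ Ty.zero ⇒ ρ)) :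
      AxEPA (eq ρ (Tm.con (Con.recN ρ) ⊙ n.suc ⊙ y ⊙ z)
        (z ⊙ (Tm.con (Con.recN ρ) ⊙ n ⊙ y ⊙ z) ⊙ n))
  /- finite sequences -/
  | seq_cases {Γ : Ctx} (σ : Ty) (x : Tm Γ (seq σ)) :
      AxEPA (or (eq (seq σ) x Tm.nil)
        (ex σ (ex (seq σ) (eq (seq σ) x.wk.wk (Tm.cons v1 v0)))))
  | recL_nil {Γ : Ctx} (σ ρ : Ty) (y : Tm Γ ρ) (z : Tm Γ (ρ ⇒ σ ⇒ ρ)) :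
      AxEPA (eq ρ (Tm.con (Con.recL σ ρ) ⊙ Tm.nil ⊙ y ⊙ z) y)
  | recL_cons {Γ : Ctx} (σ ρ : Ty) (a : Tm Γ σ) (x : Tm Γ (seq σ)) (y : Tm Γ ρ)
      (z : Tm Γ (ρ ⇒ σ ⇒ ρ)) :
      AxEPA (eq ρ (Tm.con (Con.recL σ ρ) ⊙ Tm.cons a x ⊙ y ⊙ z)
        (z ⊙ (Tm.con (Con.recL σ ρ) ⊙ x ⊙ y ⊙ z) ⊙ a))

/-- The axioms of `P`, as open formulas. -/
inductive AxP : {Γ : Ctx} → Fm Γ → Prop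
  | epa {Γ : Ctx} {φ : Fm Γ} : AxEPA φ → AxP φ
  /- the basic axioms about standardness -/
  | st_eq {Γ : Ctx} (σ : Ty) (x y : Tm Γ σ) : AxP (imp (and (st x) (eq σ x y)) (st y))
  | st_closed {σ : Ty} (t : Tm [] σ) : AxP (st t)
  | st_app {Γ : Ctx} (σ τ : Ty) (f : Tm Γ (σ ⇒ τ)) (x : Tm Γ σ) :
      AxP (imp (and (st f) (st x)) (st (f ⊙ x)))
  /- external induction, for all formulas -/
  | st_induction {Γ : Ctx} (φ : Fm (Ty.zero :: Γ)) :
      AxP (imp (and (φ.subst (Sub.inst Tm.zer))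
        (allSt Ty.zero (imp φ (φ.subst Sub.succ)))) (allSt Ty.zero φ))
  /- the herbrandized axiom of choice, for internal `φ (x, y)` with `x = v1` and `y = v0` -/
  | hac {Γ : Ctx} (ρ τ : Ty) (φ : Fm (τ :: ρ :: Γ)) : φ.Internal →
      AxP (imp (allSt ρ (exSt τ φ))
        (exSt (ρ ⇒ seq τ) (allSt ρ (ex τ
          (and (mem v0 (v2 ⊙ v1)) (φ.rename Ren.wk.lift.lift))))))
  /- idealisation, for internal `φ (z, y)` with `z = v0` and `y = v1` -/
  | idealisation {Γ : Ctx} (σ τ : Ty) (φ : Fm (σ :: τ :: Γ)) : φ.Internal →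
      AxP (imp (allSt (seq σ) (ex τ (all σ
          (imp (mem v0 v2) (φ.rename Ren.wk.lift.lift)))))
        (ex τ (allSt σ φ)))

/-- The system `P`: the universal closures of its axioms. -/
def P : Set Sentence := {φ | ∃ (Γ : Ctx) (ψ : Fm Γ), AxP ψ ∧ φ = ψ.close}

/-! ### The sentences -/

section
variable {Γ : Ctx}

/-- `α ≤₁ 1`: the type `1` object `α` is a binary sequence. -/
def binary (α : Tm Γ Ty.one) : Fm Γ := all Ty.zero (le (α.wk ⊙ v0) Tm.zer.suc)

/-- `α ≈₁ β`: the two sequences agree at all standard arguments. -/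
def approx (α β : Tm Γ Ty.one) : Fm Γ := allSt Ty.zero (eqN (α.wk ⊙ v0) (β.wk ⊙ v0))

/-- A finite sequence of numbers all of whose entries are at most `1`. -/
def binSeq (x : Tm Γ (seq Ty.zero)) : Fm Γ :=
  all Ty.zero (imp (lt v0 x.wk.len) (le (x.wk.nth v0) Tm.zer.suc))

/-- `x ∈ T`, for a set `T` of (codes of) finite sequences given by a characteristic function. -/
def inTree (x : Tm Γ (seq Ty.zero)) (T : Tm Γ Ty.one) : Fm Γ := eqN (T ⊙ x.code) Tm.zer.suc

/-- `T` is a binary tree: the characteristic function of a set of (codes of) finite binary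
sequences that is closed under initial segments. -/
def binTree (T : Tm Γ Ty.one) : Fm Γ :=
  and (binary T)
    (and
      (all Ty.zero (imp (eqN (T.wk ⊙ v0) Tm.zer.suc)
        (ex (seq Ty.zero) (and (eqN v0.code v1) (binSeq v0)))))
      (all (seq Ty.zero) (all (seq Ty.zero)
        (imp (inTree (Tm.cat v1 v0) T.wk.wk) (inTree v1 T.wk.wk)))))

/-- Every binary sequence leaves `T` at a height `i ≤ k`. -/
def bounded (T : Tm Γ Ty.one) (k : Tm Γ Ty.zero) : Fm Γ :=
  all Ty.one (imp (binary v0)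
    (ex Ty.zero (and (le v0 k.wk.wk) (neg (inTree (Tm.bar v1 v0) T.wk.wk)))))

/-- `(α, k) ∈ w` for `w` of type `1*`, the pair `(α, k)` being the type `1` object
`γ` with `γ 0 = k` and `γ (n + 1) = α n`. -/
def pairMem (α : Tm Γ Ty.one) (k : Tm Γ Ty.zero) (w : Tm Γ (seq Ty.one)) : Fm Γ :=
  ex Ty.one (and (mem v0 w.wk)
    (and (eqN (v0 ⊙ Tm.zer) k.wk)
      (all Ty.zero (eqN (v1 ⊙ v0.suc) (α.wk.wk ⊙ v0)))))

/-- The special fan functional specification. A functional with values in pairs (a number and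
a finite sequence of type `1` objects) is a pair of functionals `Θ₁` and `Θ₂`. -/
def SCF (Θ₁ : Tm Γ (Ty.two ⇒ Ty.zero)) (Θ₂ : Tm Γ (Ty.two ⇒ seq Ty.one)) : Fm Γ :=
  -- the variable `g` and then the variable `T`
  all Ty.two (all Ty.one (imp (binTree v0)
    (imp
      (all Ty.one (imp (mem v0 (Θ₂.wk.wk.wk ⊙ v2)) (neg (inTree (Tm.bar v0 (v2 ⊙ v0)) v1))))
      (bounded v0 (Θ₁.wk.wk ⊙ v1)))))

end

/-- The nonstandard compactness of Cantor space. -/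
def STP : Sentence :=
  all Ty.one (imp (binary v0) (exSt Ty.one (and (binary v0) (approx v1 v0))))

/-- The normal form; the variables are `g`, `w`, `T`, `α`, `k`, in this order. -/
def normalForm : Sentence :=
  allSt Ty.two (exSt (seq Ty.one) (all Ty.one (imp (binTree v0)
    (ex Ty.one (ex Ty.zero (and (binary v1) (and (pairMem v1 v0 v3)
      (imp (neg (inTree (Tm.bar v1 (v4 ⊙ v1)) v2)) (bounded v2 v0)))))))))

/-- There is a standard special fan functional. -/
def existsStandardSCF : Sentence :=
  exSt (Ty.two ⇒ Ty.zero) (exSt (Ty.two ⇒ seq Ty.one) (SCF v1 v0))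

end NSArith

/-! Derivability is replaced by truth in models. The calculus is complete (`proves_of_sat`). A model
of `P` can be divided by extensional equality without changing the truth of sentences, so only
models in which extensional equality is identity need to be considered (`proves_of_isModel`). In
such a model, arithmetic, finite sequences and their coding are developed from the axioms. Induction
is available only for predicates defined by formulas, so each induction names its formula.

From the normal form to `STP`: suppose a binary `α` has no standard part. Every standard `β` then
differs from `α` at some standard place. Herbrandized choice gives a standard functional listing
finitely many candidate places for each standard `β`, and one more than their sum is a standard `g`
such that `α` and `β` differ below `g(β)` (`exists_st_separating`). Let `T` be the tree of initial
segments of `α` (`exists_binTree`). Since `α` is a path, `T` is bounded by no `k`. Every standard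
`β` leaves `T` by height `g(β)`. The entries of a standard finite sequence are standard, so the
normal form for `g` and `T` is contradicted. The same argument applied to `Θ₂(g)` proves `STP` from
a standard special fan functional.

From `STP` to the normal form: suppose no standard `w` works for a standard `g`. Idealisation yields
a single tree `T` that refutes all standard pairs `(α, k)` at once: it is bounded by no standard
`k`, and every standard binary `α` leaves it at height `g(α)`. A second idealisation gives a binary
`β` all of whose initial segments of standard length lie in `T`. Its standard part `α` agrees with
`β` below the standard number `g(α)`, so the segment of `α` of length `g(α)` is in `T`, a
contradiction (`exists_st_bar_inTree`). -/

namespace NSArith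

open Ty Fm

/-! ### Structures and satisfaction -/

/-- Assignments of objects to the variables of a context. -/
abbrev Env (D : Ty → Type) (Γ : Ctx) : Type := ∀ σ : Ty, Var Γ σ → D σ

/-- Extension of an assignment by the value of the most recent variable. -/
def Env.cons {D : Ty → Type} {Γ : Ctx} {τ : Ty} (a : D τ) (e : Env D Γ) : Env D (τ :: Γ)
  | _, Var.here => a
  | _, Var.there v => e _ v

/-- The assignment in the empty context. -/
def Env.nil {D : Ty → Type} : Env D [] := fun _ v => nomatch v

theorem Env.eq_nil {D : Ty → Type} (e : Env D []) : e = Env.nil := by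
  funext σ v; cases v

theorem Env.eq_cons {D : Ty → Type} {Γ : Ctx} {τ : Ty} (e : Env D (τ :: Γ)) :
    e = Env.cons (e τ Var.here) (fun σ v => e σ (Var.there v)) := by
  funext σ v; cases v <;> rfl

/-- Structures for the language; higher type equality is not interpreted. -/
structure Str where
  D : Ty → Type
  con : ∀ {σ : Ty}, Con σ → D σ
  app : ∀ {σ τ : Ty}, D (σ ⇒ τ) → D σ → D τ
  eqN : D Ty.zero → D Ty.zero → Prop
  st : ∀ {σ : Ty}, D σ → Prop

namespace Str

variable (M : Str)

/-- The value of a term. -/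
def eval {Γ : Ctx} (e : Env M.D Γ) : {σ : Ty} → Tm Γ σ → M.D σ
  | _, Tm.var v => e _ v
  | _, Tm.con c => M.con c
  | _, Tm.app f a => M.app (eval e f) (eval e a)

/-- Satisfaction of a formula. -/
def Sat : {Γ : Ctx} → Env M.D Γ → Fm Γ → Prop
  | _, _, Fm.bot => False
  | _, e, Fm.eqN t u => M.eqN (M.eval e t) (M.eval e u)
  | _, e, Fm.st t => M.st (M.eval e t)
  | _, e, Fm.imp φ ψ => Sat e φ → Sat e ψ
  | _, e, Fm.all _ φ => ∀ a, Sat (Env.cons a e) φ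

end Str

/-! ### Substitution -/

variable {Γ Δ Θ : Ctx}

theorem Tm.rename_eq_subst (r : Ren Γ Δ) {σ : Ty} (t : Tm Γ σ) :
    t.rename r = t.subst (fun σ v => Tm.var (r σ v)) := by
  induction t with
  | var v => rfl
  | con c => rfl
  | app f a hf ha => simp [Tm.rename, Tm.subst, hf, ha]

theorem Tm.subst_subst (s : Sub Γ Δ) (s' : Sub Δ Θ) {σ : Ty} (t : Tm Γ σ) :
    (t.subst s).subst s' = t.subst (fun σ v => (s σ v).subst s') := by
  induction t with
  | var v => rfl
  | con c => rfl
  | app f a hf ha => simp [Tm.subst, hf, ha]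

theorem Tm.subst_var {σ : Ty} (t : Tm Γ σ) : t.subst (fun _ v => Tm.var v) = t := by
  induction t with
  | var v => rfl
  | con c => rfl
  | app f a hf ha => simp [Tm.subst, hf, ha]

theorem Tm.wk_subst_cons {σ τ : Ty} (t : Tm Γ σ) (a : Tm Δ τ) (s : Sub Γ Δ) :
    t.wk.subst (Env.cons a s) = t.subst s := by
  rw [Tm.wk, Tm.rename_eq_subst, Tm.subst_subst]; rfl

theorem Sub.inst_eq_cons {τ : Ty} (t : Tm Γ τ) :
    Sub.inst t = Env.cons t (fun _ v => Tm.var v) := by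
  funext σ v; cases v <;> rfl

theorem Sub.lift_eq_cons {τ : Ty} (s : Sub Γ Δ) :
    (Sub.lift s : Sub (τ :: Γ) (τ :: Δ)) = Env.cons v0 (fun σ v => (s σ v).wk) := by
  funext σ v; cases v <;> rfl

theorem Sub.lift_comp (s : Sub Γ Δ) (s' : Sub Δ Θ) {τ : Ty} :
    (fun σ v => ((s.lift : Sub (τ :: Γ) _) σ v).subst s'.lift)
      = (Sub.lift fun σ v => (s σ v).subst s') := by
  funext σ v
  cases v with
  | here => rfl
  | there v =>
    simp only [Sub.lift, Tm.wk, Tm.rename_eq_subst, Tm.subst_subst]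
    congr 1
    funext ρ w
    exact Tm.rename_eq_subst _ _

theorem Fm.rename_eq_subst (φ : Fm Γ) : ∀ {Δ : Ctx} (r : Ren Γ Δ),
    φ.rename r = φ.subst (fun σ v => Tm.var (r σ v)) := by
  induction φ with
  | bot => intros; rfl
  | eqN t u => intros; simp [Fm.rename, Fm.subst, Tm.rename_eq_subst]
  | st t => intros; simp [Fm.rename, Fm.subst, Tm.rename_eq_subst]
  | imp φ ψ h₁ h₂ => intros; simp [Fm.rename, Fm.subst, h₁, h₂]
  | all σ φ h =>
    intro Δ r
    simp only [Fm.rename, Fm.subst, h]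
    congr 2
    funext τ v; cases v <;> rfl

theorem Fm.subst_subst (φ : Fm Γ) : ∀ {Δ Θ : Ctx} (s : Sub Γ Δ) (s' : Sub Δ Θ),
    (φ.subst s).subst s' = φ.subst (fun σ v => (s σ v).subst s') := by
  induction φ with
  | bot => intros; rfl
  | eqN t u => intros; simp [Fm.subst, Tm.subst_subst]
  | st t => intros; simp [Fm.subst, Tm.subst_subst]
  | imp φ ψ h₁ h₂ => intros; simp [Fm.subst, h₁, h₂]
  | all σ φ h =>
    intros
    simp only [Fm.subst, h, Sub.lift_comp]

theorem Fm.subst_var (φ : Fm Γ) : φ.subst (fun _ v => Tm.var v) = φ := by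
  induction φ with
  | bot => rfl
  | eqN t u => simp [Fm.subst, Tm.subst_var]
  | st t => simp [Fm.subst, Tm.subst_var]
  | imp φ ψ h₁ h₂ => simp [Fm.subst, h₁, h₂]
  | @all Γ σ φ h =>
    have : (Sub.lift fun _ v => Tm.var v : Sub (σ :: Γ) (σ :: Γ)) = fun _ v => Tm.var v := by
      funext τ v; cases v <;> rfl
    rw [Fm.subst, this, h]

theorem Fm.subst_sentence (φ : Sentence) (s : Sub [] []) : φ.subst s = φ := by
  rw [Env.eq_nil s, ← Env.eq_nil (fun _ v => Tm.var v : Sub [] []), Fm.subst_var]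

theorem Fm.subst_lift_inst {τ : Ty} (φ : Fm (τ :: Γ)) (s : Sub Γ Δ) (t : Tm Δ τ) :
    (φ.subst s.lift).subst (Sub.inst t) = φ.subst (Env.cons t s) := by
  rw [Fm.subst_subst]
  congr 1
  funext σ v
  cases v with
  | here => rfl
  | there v =>
    simp only [Sub.lift, Sub.inst_eq_cons, Tm.wk_subst_cons, Tm.subst_var]; rfl

/-! ### Structural rules of the calculus. -/

theorem Prf.weaken {T : Set Sentence} {L : List (Fm Γ)} {φ : Fm Γ} (h : Prf T L φ) :
    ∀ {L' : List (Fm Γ)}, L ⊆ L' → Prf T L' φ := by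
  induction h with
  | ax h => intro L' _; exact Prf.ax h
  | hyp h => intro L' hL; exact Prf.hyp (hL h)
  | impI _ ih => intro L' hL; exact Prf.impI (ih (List.cons_subset_cons _ hL))
  | impE _ _ h₁ h₂ => intro L' hL; exact Prf.impE (h₁ hL) (h₂ hL)
  | raa _ ih => intro L' hL; exact Prf.raa (ih (List.cons_subset_cons _ hL))
  | allI _ ih => intro L' hL; exact Prf.allI (ih (List.map_subset _ hL))
  | allE t _ ih => intro L' hL; exact Prf.allE t (ih hL)

theorem Prf.exfalso {T : Set Sentence} {L : List (Fm Γ)} {φ : Fm Γ} (h : Prf T L bot) :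
    Prf T L φ :=
  Prf.raa (h.weaken (List.subset_cons_self _ _))

theorem Prf.neg_elim {T : Set Sentence} {L : List (Fm Γ)} {φ : Fm Γ} (h : Prf T L φ)
    (h' : neg φ ∈ L) : Prf T L bot :=
  Prf.impE (Prf.hyp h') h

/-! ### Named terms and formulas -/

/-- Closed terms over infinitely many names of each type. -/
inductive NTm : Ty → Type
  | name (σ : Ty) : ℕ → NTm σ
  | con {σ : Ty} : Con σ → NTm σ
  | app {σ τ : Ty} : NTm (σ ⇒ τ) → NTm σ → NTm τ

/-- The term obtained by an assignment of terms to the names. -/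
def NTm.inst (r : ∀ σ : Ty, ℕ → Tm Γ σ) : {σ : Ty} → NTm σ → Tm Γ σ
  | _, NTm.name σ n => r σ n
  | _, NTm.con c => Tm.con c
  | _, NTm.app f a => Tm.app (f.inst r) (a.inst r)

/-- A formula with an assignment of named terms to its free variables. -/
structure NFm where
  ctx : Ctx
  fm : Fm ctx
  env : Env NTm ctx

namespace NFm

/-- The substitution obtained by an assignment of terms to the names. -/
def sub (r : ∀ σ : Ty, ℕ → Tm Γ σ) (e : Env NTm Δ) : Sub Δ Γ := fun σ v => (e σ v).inst r

/-- The formula obtained by an assignment of terms to the names. -/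
def inst (r : ∀ σ : Ty, ℕ → Tm Γ σ) (A : NFm) : Fm Γ := A.fm.subst (sub r A.env)

def neg (A : NFm) : NFm := ⟨A.ctx, A.fm.neg, A.env⟩

end NFm

/-- Only finitely many names occur in a term. The bound makes it possible to choose fresh names as
Henkin witnesses. -/
theorem NTm.exists_bound {σ : Ty} (t : NTm σ) : ∃ N : ℕ, ∀ (Γ : Ctx)
    (r r' : ∀ σ : Ty, ℕ → Tm Γ σ), (∀ σ n, n < N → r σ n = r' σ n) → t.inst r = t.inst r' := by
  induction t with
  | name σ n => exact ⟨n + 1, fun Γ r r' h => h σ n (Nat.lt_succ_self n)⟩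
  | con c => exact ⟨0, fun Γ r r' h => rfl⟩
  | app f a hf ha =>
    obtain ⟨N, hN⟩ := hf
    obtain ⟨K, hK⟩ := ha
    refine ⟨max N K, fun Γ r r' h => ?_⟩
    simp only [NTm.inst]
    rw [hN Γ r r' fun σ n hn => h σ n (lt_of_lt_of_le hn (le_max_left _ _)),
      hK Γ r r' fun σ n hn => h σ n (lt_of_lt_of_le hn (le_max_right _ _))]

theorem NFm.exists_bound_env : ∀ {Δ : Ctx} (e : Env NTm Δ), ∃ N : ℕ, ∀ (Γ : Ctx)
    (r r' : ∀ σ : Ty, ℕ → Tm Γ σ), (∀ σ n, n < N → r σ n = r' σ n) →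
    NFm.sub r e = NFm.sub r' e := by
  intro Δ
  induction Δ with
  | nil => exact fun e => ⟨0, fun Γ r r' _ => by funext σ v; cases v⟩
  | cons τ Δ ih =>
    intro e
    obtain ⟨N, hN⟩ := ih (fun σ v => e σ (Var.there v))
    obtain ⟨K, hK⟩ := (e τ Var.here).exists_bound
    refine ⟨max N K, fun Γ r r' h => ?_⟩
    have h₁ := hN Γ r r' fun σ n hn => h σ n (lt_of_lt_of_le hn (le_max_left _ _))
    have h₂ := hK Γ r r' fun σ n hn => h σ n (lt_of_lt_of_le hn (le_max_right _ _))
    funext σ v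
    cases v with
    | here => exact h₂
    | there v => exact congrFun (congrFun h₁ σ) v

theorem NFm.exists_bound_list (L : List NFm) : ∃ N : ℕ, ∀ (Γ : Ctx)
    (r r' : ∀ σ : Ty, ℕ → Tm Γ σ), (∀ σ n, n < N → r σ n = r' σ n) →
    L.map (NFm.inst r) = L.map (NFm.inst r') := by
  induction L with
  | nil => exact ⟨0, fun _ _ _ _ => rfl⟩
  | cons A L ih =>
    obtain ⟨N, hN⟩ := ih
    obtain ⟨K, hK⟩ := NFm.exists_bound_env A.env
    refine ⟨max N K, fun Γ r r' h => ?_⟩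
    simp only [List.map_cons, NFm.inst]
    rw [hN Γ r r' fun σ n hn => h σ n (lt_of_lt_of_le hn (le_max_left _ _)),
      hK Γ r r' fun σ n hn => h σ n (lt_of_lt_of_le hn (le_max_right _ _))]

theorem NTm.inst_wk (r : ∀ σ : Ty, ℕ → Tm Γ σ) {σ τ : Ty} (t : NTm σ) :
    t.inst (fun σ n => ((r σ n).wk : Tm (τ :: Γ) σ)) = (t.inst r).wk := by
  induction t with
  | name σ n => rfl
  | con c => rfl
  | app f a hf ha => simp only [NTm.inst, hf, ha]; rfl

theorem NFm.sub_wk (r : ∀ σ : Ty, ℕ → Tm Γ σ) {τ : Ty} (e : Env NTm Δ) :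
    NFm.sub (fun σ n => ((r σ n).wk : Tm (τ :: Γ) σ)) e = fun σ v => (NFm.sub r e σ v).wk := by
  funext σ v
  exact NTm.inst_wk r _

theorem NFm.inst_wk (r : ∀ σ : Ty, ℕ → Tm Γ σ) {τ : Ty} (A : NFm) :
    A.inst (fun σ n => ((r σ n).wk : Tm (τ :: Γ) σ)) = (A.inst r).rename Ren.wk := by
  rw [NFm.inst, NFm.inst, Fm.rename_eq_subst, Fm.subst_subst, NFm.sub_wk]
  simp only [Tm.wk, Tm.rename_eq_subst]

theorem NFm.sub_cons (r : ∀ σ : Ty, ℕ → Tm Γ σ) {τ : Ty} (a : NTm τ) (e : Env NTm Δ) :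
    NFm.sub r (Env.cons a e) = Env.cons (a.inst r) (NFm.sub r e) := by
  funext σ v; cases v <;> rfl

/-! ### Countability -/

/-- A numbering of the types. -/
def Ty.num : Ty → ℕ
  | Ty.zero => Nat.pair 0 0
  | Ty.arr σ τ => Nat.pair 1 (Nat.pair σ.num τ.num)
  | Ty.seq σ => Nat.pair 2 σ.num

theorem Ty.num_injective : ∀ σ τ : Ty, σ.num = τ.num → σ = τ := by
  intro σ
  induction σ with
  | zero => intro τ h; cases τ <;> simp_all [Ty.num, Nat.pair_eq_pair]
  | arr σ₁ σ₂ h₁ h₂ =>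
    intro τ h
    cases τ <;> simp [Ty.num, Nat.pair_eq_pair] at h
    rw [h₁ _ h.1, h₂ _ h.2]
  | seq σ ih =>
    intro τ h
    cases τ <;> simp [Ty.num, Nat.pair_eq_pair] at h
    rw [ih _ h]

/-- A numbering of the constants. -/
def Con.num : {σ : Ty} → Con σ → ℕ
  | _, Con.zero => Nat.pair 0 0
  | _, Con.succ => Nat.pair 1 0
  | _, Con.comK σ τ => Nat.pair 2 (Nat.pair σ.num τ.num)
  | _, Con.comS ρ σ τ => Nat.pair 3 (Nat.pair ρ.num (Nat.pair σ.num τ.num))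
  | _, Con.recN ρ => Nat.pair 4 ρ.num
  | _, Con.nil σ => Nat.pair 5 σ.num
  | _, Con.cons σ => Nat.pair 6 σ.num
  | _, Con.recL σ ρ => Nat.pair 7 (Nat.pair σ.num ρ.num)

theorem Con.num_injective {σ τ : Ty} (c : Con σ) (d : Con τ) (h : c.num = d.num) :
    (⟨σ, c⟩ : Σ σ, Con σ) = ⟨τ, d⟩ := by
  cases c <;> cases d <;> simp only [Con.num, Nat.pair_eq_pair] at h <;>
    first
      | (exfalso; omega)
      | rfl
      | (cases Ty.num_injective _ _ h.2; rfl)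
      | (cases Ty.num_injective _ _ h.2.1; cases Ty.num_injective _ _ h.2.2; rfl)
      | (cases Ty.num_injective _ _ h.2.1; cases Ty.num_injective _ _ h.2.2.1
         cases Ty.num_injective _ _ h.2.2.2; rfl)

/-- A numbering of the variables. -/
def Var.num : {Γ : Ctx} → {σ : Ty} → Var Γ σ → ℕ
  | _, _, Var.here => 0
  | _, _, Var.there v => v.num + 1

theorem Var.num_injective {σ : Ty} (v : Var Γ σ) : ∀ {τ : Ty} (w : Var Γ τ), v.num = w.num →
    (⟨σ, v⟩ : Σ σ, Var Γ σ) = ⟨τ, w⟩ := by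
  induction v with
  | here => intro τ w h; cases w <;> simp_all [Var.num]
  | there v ih =>
    intro τ w h
    cases w with
    | here => simp [Var.num] at h
    | there w => cases ih w (by simpa [Var.num] using h); rfl

/-- A numbering of the terms. -/
def Tm.num : {σ : Ty} → Tm Γ σ → ℕ
  | _, Tm.var v => Nat.pair 0 v.num
  | _, Tm.con c => Nat.pair 1 c.num
  | _, Tm.app f a => Nat.pair 2 (Nat.pair f.num a.num)

/-- The types are compared together with the terms, because the type of an application does not
determine the type of its argument. -/
theorem Tm.num_injective {σ : Ty} (t : Tm Γ σ) : ∀ {τ : Ty} (u : Tm Γ τ), t.num = u.num →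
    (⟨σ, t⟩ : Σ σ, Tm Γ σ) = ⟨τ, u⟩ := by
  induction t with
  | var v =>
    intro τ u h
    cases u <;> simp [Tm.num, Nat.pair_eq_pair] at h
    cases Var.num_injective _ _ h; rfl
  | con c =>
    intro τ u h
    cases u <;> simp [Tm.num, Nat.pair_eq_pair] at h
    cases Con.num_injective _ _ h; rfl
  | app f a hf ha =>
    intro τ u h
    cases u <;> simp [Tm.num, Nat.pair_eq_pair] at h
    cases hf _ h.1; cases ha _ h.2; rfl

/-- A numbering of the named terms. -/
def NTm.num : {σ : Ty} → NTm σ → ℕ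
  | _, NTm.name σ n => Nat.pair 0 (Nat.pair σ.num n)
  | _, NTm.con c => Nat.pair 1 c.num
  | _, NTm.app f a => Nat.pair 2 (Nat.pair f.num a.num)

theorem NTm.num_injective {σ : Ty} (t : NTm σ) : ∀ {τ : Ty} (u : NTm τ), t.num = u.num →
    (⟨σ, t⟩ : Σ σ, NTm σ) = ⟨τ, u⟩ := by
  induction t with
  | name σ n =>
    intro τ u h
    cases u <;> simp [NTm.num, Nat.pair_eq_pair] at h
    cases Ty.num_injective _ _ h.1; cases h.2; rfl
  | con c =>
    intro τ u h
    cases u <;> simp [NTm.num, Nat.pair_eq_pair] at h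
    cases Con.num_injective _ _ h; rfl
  | app f a hf ha =>
    intro τ u h
    cases u <;> simp [NTm.num, Nat.pair_eq_pair] at h
    cases hf _ h.1; cases ha _ h.2; rfl

/-- A numbering of the formulas. -/
def Fm.num : {Γ : Ctx} → Fm Γ → ℕ
  | _, Fm.bot => Nat.pair 0 0
  | _, Fm.eqN t u => Nat.pair 1 (Nat.pair t.num u.num)
  | _, Fm.st t => Nat.pair 2 t.num
  | _, Fm.imp φ ψ => Nat.pair 3 (Nat.pair φ.num ψ.num)
  | _, Fm.all σ φ => Nat.pair 4 (Nat.pair σ.num φ.num)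

theorem Fm.num_injective (φ : Fm Γ) : ∀ ψ : Fm Γ, φ.num = ψ.num → φ = ψ := by
  induction φ with
  | bot => intro ψ h; cases ψ <;> simp_all [Fm.num, Nat.pair_eq_pair]
  | eqN t u =>
    intro ψ h
    cases ψ <;> simp [Fm.num, Nat.pair_eq_pair] at h
    cases Tm.num_injective _ _ h.1; cases Tm.num_injective _ _ h.2; rfl
  | st t =>
    intro ψ h
    cases ψ <;> simp [Fm.num, Nat.pair_eq_pair] at h
    cases Tm.num_injective _ _ h; rfl
  | imp φ₁ φ₂ h₁ h₂ =>
    intro ψ h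
    cases ψ <;> simp [Fm.num, Nat.pair_eq_pair] at h
    cases h₁ _ h.1; cases h₂ _ h.2; rfl
  | all σ φ ih =>
    intro ψ h
    cases ψ <;> simp [Fm.num, Nat.pair_eq_pair] at h
    cases Ty.num_injective _ _ h.1; cases ih _ h.2; rfl

instance : Countable Ty := ⟨Ty.num, fun _ _ => Ty.num_injective _ _⟩

instance (Γ : Ctx) : Countable (Fm Γ) := ⟨Fm.num, fun _ _ => Fm.num_injective _ _⟩

instance (σ : Ty) : Countable (NTm σ) :=
  ⟨NTm.num, fun _ _ h => by cases NTm.num_injective _ _ h; rfl⟩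

theorem countable_env : ∀ Γ : Ctx, Countable (Env NTm Γ) := by
  intro Γ
  induction Γ with
  | nil => exact ⟨fun _ => 0, fun e e' _ => by rw [e.eq_nil, e'.eq_nil]⟩
  | cons τ Γ ih =>
    refine Function.Injective.countable (β := NTm τ × Env NTm Γ)
      (f := fun e => (e τ Var.here, fun σ v => e σ (Var.there v))) fun e e' h => ?_
    rw [e.eq_cons, e'.eq_cons]
    simp only [Prod.mk.injEq] at h
    rw [h.1, h.2]

instance : Countable NFm := by
  have := countable_env
  refine Function.Injective.countable (β := Σ Γ : Ctx, Fm Γ × Env NTm Γ)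
    (f := fun A => ⟨A.ctx, A.fm, A.env⟩) fun A B h => ?_
  cases A; cases B
  simp only [Sigma.mk.injEq] at h
  obtain ⟨rfl, h⟩ := h
  simp only [heq_eq_eq, Prod.mk.injEq] at h
  rw [h.1, h.2]

/-! ### Completeness -/

section Completeness

variable (T : Set Sentence)

/-- Derivability, under every assignment of terms to the names. -/
def Forces (L : List NFm) (X : ∀ Γ : Ctx, (∀ σ : Ty, ℕ → Tm Γ σ) → Fm Γ) : Prop :=
  ∀ (Γ : Ctx) (r : ∀ σ : Ty, ℕ → Tm Γ σ), Prf T (L.map (NFm.inst r)) (X Γ r)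

/-- Consistency of a finite list of named formulas. -/
def Consistent (L : List NFm) : Prop := ¬ Forces T L fun _ _ => bot

/-- Consistent finite lists, ordered by inclusion. -/
structure Cond : Type where
  list : List NFm
  consistent : Consistent T list

instance : Preorder (Cond T) where
  le L L' := L.list ⊆ L'.list
  le_refl _ := List.Subset.refl _
  le_trans _ _ _ := List.Subset.trans

variable {T}

theorem Forces.mono {L L' : List NFm} {X : ∀ Γ : Ctx, (∀ σ : Ty, ℕ → Tm Γ σ) → Fm Γ}
    (h : Forces T L X) (hL : L ⊆ L') : Forces T L' X :=
  fun Γ r => (h Γ r).weaken (List.map_subset _ hL)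

theorem Consistent.cons_or_cons_neg {L : List NFm} (h : Consistent T L) (A : NFm) :
    Consistent T (A :: L) ∨ Consistent T (A.neg :: L) := by
  by_contra! hc
  simp only [Consistent, not_not] at hc
  exact h fun Γ r => Prf.impE (Prf.impI (hc.1 Γ r)) (Prf.raa (hc.2 Γ r))

/-- A fresh name serves as the counterexample. If adding it were inconsistent, the name could be
read as an eigenvariable, and generalisation would derive the universal formula whose negation is in
`L`. -/
theorem Consistent.cons_witness {L : List NFm} {τ : Ty} {φ : Fm (τ :: Γ)} {e : Env NTm Γ}
    (h : Consistent T L) (hA : NFm.mk Γ (neg (all τ φ)) e ∈ L) :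
    ∃ c : NTm τ, Consistent T (⟨τ :: Γ, neg φ, Env.cons c e⟩ :: L) := by
  obtain ⟨N, hN⟩ := NFm.exists_bound_list (⟨Γ, neg (all τ φ), e⟩ :: L)
  obtain ⟨K, hK⟩ := NFm.exists_bound_env e
  refine ⟨NTm.name τ (max N K), fun hc => h fun Δ r => ?_⟩
  classical
  -- The fresh name goes to the new variable, all other names to their weakened values. On the names
  -- that occur in `L` and `e` this is just weakening.
  let r' : ∀ σ : Ty, ℕ → Tm (τ :: Δ) σ := fun σ n =>
    if hσ : τ = σ ∧ n = max N K then hσ.1 ▸ v0 else (r σ n).wk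
  have hr' : ∀ σ n, n < max N K → r' σ n = (r σ n).wk := fun σ n hn =>
    dif_neg fun hσ => absurd hσ.2 hn.ne
  have hc' : r' τ (max N K) = v0 := dif_pos ⟨rfl, rfl⟩
  have h₁ := hN _ r' (fun σ n => (r σ n).wk) fun σ n hn =>
    hr' σ n (lt_of_lt_of_le hn (le_max_left _ _))
  have h₂ := hK _ r' (fun σ n => (r σ n).wk) fun σ n hn =>
    hr' σ n (lt_of_lt_of_le hn (le_max_right _ _))
  have h₃ := hc _ r'
  simp only [List.map_cons, List.cons.injEq] at h₁ h₃
  rw [h₁.2] at h₃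
  have h₄ : NFm.inst r' ⟨τ :: Γ, neg φ, Env.cons (NTm.name τ (max N K)) e⟩
      = neg (φ.subst (NFm.sub r e).lift) := by
    simp only [NFm.inst, NFm.sub_cons, h₂, NFm.sub_wk, NTm.inst, hc', Sub.lift_eq_cons]
    rfl
  rw [h₄] at h₃
  have h₅ : L.map (NFm.inst fun σ n => ((r σ n).wk : Tm (τ :: Δ) σ))
      = (L.map (NFm.inst r)).map (Fm.rename Ren.wk) := by
    rw [List.map_map]
    exact List.map_congr_left fun A _ => NFm.inst_wk r A
  rw [h₅] at h₃
  exact Prf.neg_elim (Prf.allI (Prf.raa h₃)) (List.mem_map_of_mem (f := NFm.inst r) hA)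

/-- The conditions that decide a named formula, with a witness against a universal formula. -/
def Deciding (A : NFm) : Set (Cond T) :=
  {L | A ∈ L.list ∨ A.neg ∈ L.list ∧ ∀ (Γ : Ctx) (τ : Ty) (φ : Fm (τ :: Γ)) (e : Env NTm Γ),
    A = ⟨Γ, all τ φ, e⟩ → ∃ c : NTm τ, NFm.mk (τ :: Γ) (neg φ) (Env.cons c e) ∈ L.list}

theorem isCofinal_deciding (A : NFm) : IsCofinal (Deciding (T := T) A) := by
  rintro ⟨L, hL⟩
  rcases hL.cons_or_cons_neg A with h | h
  · exact ⟨⟨_, h⟩, Or.inl List.mem_cons_self, List.subset_cons_self _ _⟩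
  · by_cases hA : ∃ (Γ : Ctx) (τ : Ty) (φ : Fm (τ :: Γ)) (e : Env NTm Γ), A = ⟨Γ, all τ φ, e⟩
    · obtain ⟨Γ, τ, φ, e, rfl⟩ := hA
      obtain ⟨c, hc⟩ := h.cons_witness (φ := φ) (e := e) List.mem_cons_self
      refine ⟨⟨_, hc⟩, Or.inr ⟨List.mem_cons_of_mem _ List.mem_cons_self, ?_⟩,
        List.Subset.trans (List.subset_cons_self _ _) (List.subset_cons_self _ _)⟩
      rintro Γ' τ' φ' e' h'
      cases h'
      exact ⟨c, List.mem_cons_self⟩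
    · exact ⟨⟨_, h⟩, Or.inr ⟨List.mem_cons_self, fun Γ τ φ e h' => absurd ⟨Γ, τ, φ, e, h'⟩ hA⟩,
        List.subset_cons_self _ _⟩

/-- Truth in an ideal of conditions. -/
def Holds (I : Order.Ideal (Cond T)) (X : ∀ Γ : Ctx, (∀ σ : Ty, ℕ → Tm Γ σ) → Fm Γ) : Prop :=
  ∃ L ∈ I, Forces T L.list X

theorem Holds.mp {I : Order.Ideal (Cond T)}
    {X Y : ∀ Γ : Ctx, (∀ σ : Ty, ℕ → Tm Γ σ) → Fm Γ}
    (h : Holds I fun Γ r => imp (X Γ r) (Y Γ r)) (h' : Holds I X) : Holds I Y := by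
  obtain ⟨L, hL, h⟩ := h
  obtain ⟨L', hL', h'⟩ := h'
  obtain ⟨K, hK, h₁, h₂⟩ := I.directed _ hL _ hL'
  exact ⟨K, hK, fun Γ r => Prf.impE (h.mono h₁ Γ r) (h'.mono h₂ Γ r)⟩

theorem not_holds_bot (I : Order.Ideal (Cond T)) : ¬ Holds I fun _ _ => bot := by
  rintro ⟨L, -, h⟩
  exact L.consistent h

theorem holds_of_mem {I : Order.Ideal (Cond T)} {L : Cond T} (hL : L ∈ I) {A : NFm}
    (hA : A ∈ L.list) : Holds I fun _ r => A.inst r :=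
  ⟨L, hL, fun _ r => Prf.hyp (List.mem_map_of_mem (f := NFm.inst r) hA)⟩

/-- The term model given by an ideal of conditions. -/
def termModel (I : Order.Ideal (Cond T)) : Str where
  D := NTm
  con := NTm.con
  app := NTm.app
  eqN a b := Holds I fun _ r => Fm.eqN (a.inst r) (b.inst r)
  st a := Holds I fun _ r => Fm.st (a.inst r)

theorem eval_termModel (I : Order.Ideal (Cond T)) (e : Env NTm Γ) {σ : Ty} (t : Tm Γ σ)
    (r : ∀ σ : Ty, ℕ → Tm Δ σ) :
    ((termModel I).eval e t : NTm σ).inst r = t.subst (NFm.sub r e) := by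
  induction t with
  | var v => rfl
  | con c => rfl
  | app f a hf ha => simp only [Str.eval, Tm.subst, ← hf, ← ha]; rfl

/-- The truth lemma for a generic ideal. That every formula is decided handles implications; the
witnesses handle universal formulas. -/
theorem sat_termModel {I : Order.Ideal (Cond T)}
    (hI : ∀ A : NFm, ∃ L ∈ Deciding (T := T) A, L ∈ I) (φ : Fm Γ) :
    ∀ e : Env NTm Γ, (termModel I).Sat e φ ↔ Holds I fun _ r => φ.subst (NFm.sub r e) := by
  induction φ with
  | bot => exact fun e => ⟨False.elim, not_holds_bot I⟩
  | eqN t u => intro e; simp only [Str.Sat, ← eval_termModel I, Fm.subst]; rfl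
  | st t => intro e; simp only [Str.Sat, ← eval_termModel I, Fm.subst]; rfl
  | @imp Γ φ ψ h₁ h₂ =>
    intro e
    simp only [Str.Sat, h₁, h₂]
    refine ⟨fun h => ?_, fun h h' => Holds.mp h h'⟩
    obtain ⟨L, hL | hL, hLI⟩ := hI ⟨Γ, φ, e⟩
    · obtain ⟨K, hK, hψ⟩ := h (holds_of_mem hLI hL)
      exact ⟨K, hK, fun Δ r => Prf.impI ((hψ Δ r).weaken (List.subset_cons_self _ _))⟩
    · refine ⟨L, hLI, fun Δ r => Prf.impI (Prf.exfalso
        (Prf.neg_elim (φ := φ.subst (NFm.sub r e)) (Prf.hyp ?_) ?_))⟩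
      · exact List.mem_cons_self
      · exact List.mem_cons_of_mem _ (List.mem_map_of_mem (f := NFm.inst r) hL.1)
  | @all Γ τ φ ih =>
    intro e
    have ih' : ∀ a : NTm τ, (termModel I).Sat (Env.cons (D := NTm) a e) φ ↔
        Holds I fun _ r => φ.subst (NFm.sub r (Env.cons a e)) := fun a => ih _
    refine ⟨fun h => ?_, fun h a => (ih' a).2 ?_⟩
    · obtain ⟨L, hL | hL, hLI⟩ := hI ⟨Γ, all τ φ, e⟩
      · exact holds_of_mem hLI hL
      · obtain ⟨c, hc⟩ := hL.2 _ _ _ _ rfl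
        exact absurd (Holds.mp (holds_of_mem hLI hc) ((ih' c).1 (h c))) (not_holds_bot I)
    · obtain ⟨L, hL, hφ⟩ := h
      refine ⟨L, hL, fun Δ r => ?_⟩
      have h₁ := Prf.allE (a.inst r) (hφ Δ r)
      rw [Fm.subst_lift_inst, ← NFm.sub_cons r a e] at h₁
      exact h₁

/-- Gödel's completeness theorem for the calculus. -/
theorem proves_of_sat {φ : Sentence}
    (h : ∀ M : Str, (∀ ψ ∈ T, M.Sat Env.nil ψ) → M.Sat Env.nil φ) : Proves T φ := by
  by_contra hφ
  -- Every type has a closed term, so the names can be instantiated in the empty context and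
  -- inconsistency becomes a derivation there.
  have hL : Consistent T [⟨[], neg φ, Env.nil⟩] := fun hc => hφ <| Prf.raa <| by
    have h₁ := hc [] fun σ _ => dflt σ
    simp only [List.map_cons, List.map_nil, NFm.inst] at h₁
    rwa [Fm.subst_sentence] at h₁
  have := Encodable.ofCountable NFm
  let p : Cond T := ⟨_, hL⟩
  -- There are countably many named formulas, hence countably many cofinal sets to meet
  -- (Rasiowa–Sikorski).
  let I := Order.idealOfCofinals p fun A : NFm =>
    (⟨Deciding A, isCofinal_deciding A⟩ : Order.Cofinal (Cond T))
  have hI : ∀ A : NFm, ∃ L ∈ Deciding (T := T) A, L ∈ I :=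
    Order.cofinal_meets_idealOfCofinals p fun A : NFm => ⟨Deciding A, isCofinal_deciding A⟩
  have h₁ := h (termModel I) fun ψ hψ => (sat_termModel hI ψ _).2
    ⟨_, Order.mem_idealOfCofinals _ _, fun Δ r => by
      have := Prf.ax (Δ := List.map (NFm.inst r) [⟨[], neg φ, Env.nil⟩]) (Γ := Δ) hψ
      rwa [Fm.rename_eq_subst, Env.eq_nil (fun _ _ => Tm.var _ : Sub [] Δ),
        ← Env.eq_nil (NFm.sub r Env.nil : Sub [] Δ)] at this⟩
  exact not_holds_bot I (Holds.mp
    (holds_of_mem (Order.mem_idealOfCofinals _ _) (A := ⟨[], neg φ, Env.nil⟩)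
      (List.mem_singleton_self _)) ((sat_termModel hI φ _).1 h₁))

end Completeness

/-! ### Semantics of the defined notions -/

namespace Str

variable (M : Str) {Γ Δ : Ctx} (e : Env M.D Γ)

@[simp] theorem eval_var {σ : Ty} (v : Var Γ σ) : M.eval e (Tm.var v) = e σ v := rfl

@[simp] theorem eval_con {σ : Ty} (c : Con σ) : M.eval e (Tm.con c) = M.con c := rfl

@[simp] theorem eval_app {σ τ : Ty} (f : Tm Γ (σ ⇒ τ)) (a : Tm Γ σ) :
    M.eval e (f ⊙ a) = M.app (M.eval e f) (M.eval e a) := rfl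

end Str

@[simp] theorem Env.cons_here {D : Ty → Type} {Γ : Ctx} {τ : Ty} (a : D τ) (e : Env D Γ) :
    Env.cons a e τ Var.here = a := rfl

@[simp] theorem Env.cons_there {D : Ty → Type} {Γ : Ctx} {σ τ : Ty} (a : D τ) (e : Env D Γ)
    (v : Var Γ σ) : Env.cons a e σ (Var.there v) = e σ v := rfl

namespace Str

variable (M : Str) {Γ Δ : Ctx} (e : Env M.D Γ)

theorem eval_rename (r : Ren Δ Γ) {σ : Ty} (t : Tm Δ σ) :
    M.eval e (t.rename r) = M.eval (fun σ v => e σ (r σ v)) t := by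
  induction t with
  | var v => rfl
  | con c => rfl
  | app f a hf ha => simp [Tm.rename, hf, ha]

theorem eval_subst (s : Sub Δ Γ) {σ : Ty} (t : Tm Δ σ) :
    M.eval e (t.subst s) = M.eval (fun σ v => M.eval e (s σ v)) t := by
  induction t with
  | var v => rfl
  | con c => rfl
  | app f a hf ha => simp [Tm.subst, hf, ha]

@[simp] theorem eval_wk {σ τ : Ty} (a : M.D τ) (t : Tm Γ σ) :
    M.eval (Env.cons a e) t.wk = M.eval e t := by
  rw [Tm.wk, eval_rename]; rfl

@[simp] theorem eval_up {σ : Ty} (t : Tm [] σ) : M.eval e t.up = M.eval Env.nil t := by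
  rw [Tm.up, eval_rename, Env.eq_nil fun σ v => e σ (Ren.empty σ v)]

theorem sat_subst (φ : Fm Δ) : ∀ {Γ : Ctx} (e : Env M.D Γ) (s : Sub Δ Γ),
    M.Sat e (φ.subst s) ↔ M.Sat (fun σ v => M.eval e (s σ v)) φ := by
  induction φ with
  | bot => intros; rfl
  | eqN t u => intros; simp [Fm.subst, Sat, eval_subst]
  | st t => intros; simp [Fm.subst, Sat, eval_subst]
  | imp φ ψ h₁ h₂ => intros; simp [Fm.subst, Sat, h₁, h₂]
  | @all Δ τ φ h =>
    intro Γ e s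
    simp only [Fm.subst, Sat, h]
    refine forall_congr' fun a => ?_
    have : (fun σ v => M.eval (Env.cons a e) ((s.lift : Sub (τ :: Δ) _) σ v))
        = Env.cons a (fun σ v => M.eval e (s σ v)) := by
      funext σ v
      cases v <;> simp [Sub.lift]
    rw [this]

@[simp] theorem sat_bot : M.Sat e bot ↔ False := Iff.rfl

@[simp] theorem sat_st {σ : Ty} (t : Tm Γ σ) : M.Sat e (Fm.st t) ↔ M.st (M.eval e t) := Iff.rfl

@[simp] theorem sat_imp (φ ψ : Fm Γ) : M.Sat e (imp φ ψ) ↔ (M.Sat e φ → M.Sat e ψ) := Iff.rfl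

@[simp] theorem sat_all {σ : Ty} (φ : Fm (σ :: Γ)) :
    M.Sat e (all σ φ) ↔ ∀ a, M.Sat (Env.cons a e) φ := Iff.rfl

@[simp] theorem sat_neg (φ : Fm Γ) : M.Sat e (neg φ) ↔ ¬ M.Sat e φ := Iff.rfl

@[simp] theorem sat_and (φ ψ : Fm Γ) : M.Sat e (Fm.and φ ψ) ↔ M.Sat e φ ∧ M.Sat e ψ := by
  simp [Fm.and]

@[simp] theorem sat_or (φ ψ : Fm Γ) : M.Sat e (Fm.or φ ψ) ↔ M.Sat e φ ∨ M.Sat e ψ := by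
  simp [Fm.or, or_iff_not_imp_left]

@[simp] theorem sat_iff (φ ψ : Fm Γ) : M.Sat e (Fm.iff φ ψ) ↔ (M.Sat e φ ↔ M.Sat e ψ) := by
  simp [Fm.iff, iff_iff_implies_and_implies]

@[simp] theorem sat_ex {σ : Ty} (φ : Fm (σ :: Γ)) :
    M.Sat e (ex σ φ) ↔ ∃ a, M.Sat (Env.cons a e) φ := by
  simp [ex]

@[simp] theorem sat_allSt {σ : Ty} (φ : Fm (σ :: Γ)) :
    M.Sat e (allSt σ φ) ↔ ∀ a, M.st a → M.Sat (Env.cons a e) φ := by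
  simp [allSt]

@[simp] theorem sat_exSt {σ : Ty} (φ : Fm (σ :: Γ)) :
    M.Sat e (exSt σ φ) ↔ ∃ a, M.st a ∧ M.Sat (Env.cons a e) φ := by
  simp [exSt]

theorem sat_rename (φ : Fm Δ) (r : Ren Δ Γ) :
    M.Sat e (φ.rename r) ↔ M.Sat (fun σ v => e σ (r σ v)) φ := by
  rw [Fm.rename_eq_subst, sat_subst]; rfl

theorem sat_close : ∀ {Γ : Ctx} (φ : Fm Γ),
    M.Sat Env.nil φ.close ↔ ∀ e : Env M.D Γ, M.Sat e φ := by
  intro Γ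
  induction Γ with
  | nil => exact fun φ => ⟨fun h e => by rwa [e.eq_nil], fun h => h _⟩
  | cons τ Γ ih =>
    intro φ
    rw [Fm.close, ih]
    exact ⟨fun h e => by rw [e.eq_cons]; exact h _ _, fun h e a => h _⟩

/-! ### Extensional equality -/

/-- Extensional equality of objects. -/
def Eq {σ : Ty} (a b : M.D σ) : Prop :=
  M.Sat (Env.cons b (Env.cons a Env.nil)) (Fm.eq σ v1 v0)

/-- The length of a sequence. -/
def len {σ : Ty} (x : M.D (seq σ)) : M.D Ty.zero := M.app (M.eval Env.nil (lenC σ)) x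

/-- An entry of a sequence. -/
def nth {σ : Ty} (x : M.D (seq σ)) (i : M.D Ty.zero) : M.D σ :=
  M.app (M.app (M.eval Env.nil (nthC σ)) x) i

@[simp] theorem eval_len {σ : Ty} (x : Tm Γ (seq σ)) :
    M.eval e x.len = M.len (M.eval e x) := by
  simp [Tm.len, len]

@[simp] theorem eval_nth {σ : Ty} (x : Tm Γ (seq σ)) (i : Tm Γ Ty.zero) :
    M.eval e (x.nth i) = M.nth (M.eval e x) (M.eval e i) := by
  simp [Tm.nth, nth]

theorem sat_lt_congr {e : Env M.D Γ} {e' : Env M.D Δ} {m n : Tm Γ Ty.zero} {m' n' : Tm Δ Ty.zero}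
    (hm : M.eval e m = M.eval e' m') (hn : M.eval e n = M.eval e' n') :
    M.Sat e (lt m n) ↔ M.Sat e' (lt m' n') := by
  simp [lt, le, Sat, Tm.add, Tm.suc, hm, hn]

/-- This makes extensional equality a relation between objects, independent of the terms and
contexts that present them. -/
theorem sat_eq_congr : ∀ {σ : Ty} {Γ Δ : Ctx} {e : Env M.D Γ} {e' : Env M.D Δ} {t u : Tm Γ σ}
    {t' u' : Tm Δ σ}, M.eval e t = M.eval e' t' → M.eval e u = M.eval e' u' →
    (M.Sat e (Fm.eq σ t u) ↔ M.Sat e' (Fm.eq σ t' u')) := by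
  intro σ
  induction σ with
  | zero => intro Γ Δ e e' t u t' u' ht hu; simp only [Fm.eq, Sat, ht, hu]
  | arr σ τ _ ih =>
    intro Γ Δ e e' t u t' u' ht hu
    simp only [Fm.eq, sat_all]
    exact forall_congr' fun a => ih (by simp [ht]) (by simp [hu])
  | seq σ ih =>
    intro Γ Δ e e' t u t' u' ht hu
    simp only [Fm.eq, sat_and, sat_all, sat_imp]
    refine and_congr (by simp [Sat, ht, hu]) (forall_congr' fun a => imp_congr ?_ ?_)
    · exact M.sat_lt_congr rfl (by simp [ht])
    · exact ih (by simp [ht]) (by simp [hu])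

theorem sat_eq_iff_eq {σ : Ty} (t u : Tm Γ σ) :
    M.Sat e (Fm.eq σ t u) ↔ M.Eq (M.eval e t) (M.eval e u) :=
  M.sat_eq_congr rfl rfl

theorem eq_zero_iff (a b : M.D Ty.zero) : M.Eq a b ↔ M.eqN a b := Iff.rfl

theorem eq_arr_iff {σ τ : Ty} (f g : M.D (σ ⇒ τ)) :
    M.Eq f g ↔ ∀ a, M.Eq (M.app f a) (M.app g a) :=
  forall_congr' fun a => by rw [sat_eq_iff_eq]; simp

theorem eq_seq_iff {σ : Ty} (x y : M.D (seq σ)) :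
    M.Eq x y ↔ M.eqN (M.len x) (M.len y) ∧ ∀ i,
      M.Sat (Env.cons i (Env.cons (M.len x) Env.nil)) (lt v0 v1) →
        M.Eq (M.nth x i) (M.nth y i) := by
  rw [Eq, Fm.eq, sat_and, sat_all]
  refine and_congr (by simp [Sat]) (forall_congr' fun i => ?_)
  rw [sat_imp, sat_eq_iff_eq]
  refine imp_congr (M.sat_lt_congr rfl (by simp)) (by simp)

/-- Validity of all axioms of `P` under all assignments. -/
def Models : Prop := ∀ {Γ : Ctx} {φ : Fm Γ}, AxP φ → ∀ e : Env M.D Γ, M.Sat e φ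

variable {M}

theorem models_of_sat (h : ∀ φ ∈ P, M.Sat Env.nil φ) : M.Models :=
  fun hφ => (M.sat_close _).1 (h _ ⟨_, _, hφ, rfl⟩)

/-! ### The quotient of a model by extensional equality. -/

namespace Models

variable (h : M.Models)
include h

theorem eqN_refl (a : M.D Ty.zero) : M.eqN a a :=
  h (AxP.epa (AxEPA.eq_refl (v0 : Tm [Ty.zero] _))) (Env.cons a Env.nil)

theorem eqN_symm {a b : M.D Ty.zero} (hab : M.eqN a b) : M.eqN b a :=
  h (AxP.epa (AxEPA.eq_symm (v0 : Tm [Ty.zero, Ty.zero] _) v1))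
    (Env.cons a (Env.cons b Env.nil)) hab

theorem eqN_trans {a b c : M.D Ty.zero} (hab : M.eqN a b) (hbc : M.eqN b c) : M.eqN a c :=
  h (AxP.epa (AxEPA.eq_trans (v0 : Tm [Ty.zero, Ty.zero, Ty.zero] _) v1 v2))
    (Env.cons a (Env.cons b (Env.cons c Env.nil))) hab hbc

/-- Equality of sequences bounds the index by the length of the first sequence only; symmetry and
transitivity have to move this bound to the other length. -/
theorem lt_congr {i m n : M.D Ty.zero} (hmn : M.eqN m n)
    (him : M.Sat (Env.cons i (Env.cons m Env.nil)) (lt v0 v1)) :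
    M.Sat (Env.cons i (Env.cons n Env.nil)) (lt v0 v1) := by
  simp only [lt, le, sat_ex, Sat] at him ⊢
  obtain ⟨z, hz⟩ := him
  exact ⟨z, h.eqN_trans hz hmn⟩

theorem eq_equivalence : ∀ σ : Ty, Equivalence (M.Eq (σ := σ)) := by
  intro σ
  induction σ with
  | zero => exact ⟨h.eqN_refl, h.eqN_symm, h.eqN_trans⟩
  | arr σ τ _ ih =>
    refine ⟨fun f => ?_, fun {f g} hfg => ?_, fun {f g k} hfg hgk => ?_⟩
    · exact (M.eq_arr_iff _ _).2 fun a => ih.refl _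
    · exact (M.eq_arr_iff _ _).2 fun a => ih.symm ((M.eq_arr_iff _ _).1 hfg a)
    · exact (M.eq_arr_iff _ _).2 fun a =>
        ih.trans ((M.eq_arr_iff _ _).1 hfg a) ((M.eq_arr_iff _ _).1 hgk a)
  | seq σ ih =>
    refine ⟨fun x => ?_, fun {x y} hxy => ?_, fun {x y z} hxy hyz => ?_⟩
    · exact (M.eq_seq_iff _ _).2 ⟨h.eqN_refl _, fun i _ => ih.refl _⟩
    · rw [eq_seq_iff] at hxy ⊢
      exact ⟨h.eqN_symm hxy.1, fun i hi => ih.symm (hxy.2 i (h.lt_congr (h.eqN_symm hxy.1) hi))⟩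
    · rw [eq_seq_iff] at hxy hyz ⊢
      exact ⟨h.eqN_trans hxy.1 hyz.1, fun i hi =>
        ih.trans (hxy.2 i hi) (hyz.2 i (h.lt_congr hxy.1 hi))⟩

/-- Changing the function is pointwise equality; changing the argument is the axiom of
extensionality for `g`. -/
theorem eq_app {σ τ : Ty} {f g : M.D (σ ⇒ τ)} {a b : M.D σ} (hfg : M.Eq f g) (hab : M.Eq a b) :
    M.Eq (M.app f a) (M.app g b) := by
  refine (h.eq_equivalence τ).trans ((M.eq_arr_iff _ _).1 hfg a) ?_
  have h₁ := h (AxP.epa (AxEPA.ext σ τ (v0 : Tm [σ, σ, σ ⇒ τ] _) v1 v2))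
    (Env.cons a (Env.cons b (Env.cons g Env.nil)))
  rw [sat_imp, sat_eq_iff_eq, sat_eq_iff_eq] at h₁
  exact h₁ hab

theorem st_congr {σ : Ty} {a b : M.D σ} (hab : M.Eq a b) (ha : M.st a) : M.st b := by
  have h₁ := h (AxP.st_eq σ (v0 : Tm [σ, σ] _) v1) (Env.cons a (Env.cons b Env.nil))
  rw [sat_imp, sat_and, sat_eq_iff_eq] at h₁
  exact h₁ ⟨ha, hab⟩

/-- Extensional equality as a setoid. -/
def setoid (σ : Ty) : Setoid (M.D σ) := ⟨M.Eq, h.eq_equivalence σ⟩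

/-- The quotient of a model by extensional equality. -/
def quot : Str where
  D σ := Quotient (h.setoid σ)
  con c := Quotient.mk _ (M.con c)
  app := Quotient.map₂ M.app fun _ _ hf _ _ ha => h.eq_app hf ha
  eqN := Quotient.lift₂ M.eqN fun _ _ _ _ ha hb => propext
    ⟨fun hab => h.eqN_trans (h.eqN_symm ha) (h.eqN_trans hab hb),
      fun hab => h.eqN_trans ha (h.eqN_trans hab (h.eqN_symm hb))⟩
  st {σ} := Quotient.lift M.st fun _ _ hab => propext
    ⟨h.st_congr hab, h.st_congr ((h.eq_equivalence σ).symm hab)⟩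

/-- The assignment of the classes. -/
def quotEnv (e : Env M.D Γ) : Env h.quot.D Γ := fun σ v => Quotient.mk (h.setoid σ) (e σ v)

theorem eval_quot (e : Env M.D Γ) {σ : Ty} (t : Tm Γ σ) :
    h.quot.eval (h.quotEnv e) t = Quotient.mk (h.setoid σ) (M.eval e t) := by
  induction t with
  | var v => rfl
  | con c => rfl
  | app f a hf ha => rw [eval_app, hf, ha]; rfl

theorem quotEnv_cons (e : Env M.D Γ) {τ : Ty} (a : M.D τ) :
    h.quotEnv (Env.cons a e) = Env.cons (Quotient.mk (h.setoid τ) a : h.quot.D τ) (h.quotEnv e) := by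
  funext σ v; cases v <;> rfl

theorem sat_quot (φ : Fm Γ) : ∀ e : Env M.D Γ, h.quot.Sat (h.quotEnv e) φ ↔ M.Sat e φ := by
  induction φ with
  | bot => exact fun _ => Iff.rfl
  | eqN t u => intro e; rw [Sat, eval_quot, eval_quot]; rfl
  | st t => intro e; rw [Sat, eval_quot]; rfl
  | imp φ ψ h₁ h₂ => intro e; rw [sat_imp, sat_imp, h₁, h₂]
  | all τ φ ih =>
    intro e
    rw [sat_all, sat_all]
    refine ⟨fun H a => (ih _).1 ?_, fun H a => ?_⟩
    · rw [quotEnv_cons]; exact H _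
    · induction a using Quotient.ind with
      | _ a =>
      rw [← quotEnv_cons]
      exact (ih _).2 (H a)

theorem sat_quot_sentence (φ : Sentence) : h.quot.Sat Env.nil φ ↔ M.Sat Env.nil φ := by
  rw [← h.sat_quot, Env.eq_nil (h.quotEnv _)]

/-- Passing to the quotient preserves all formulas, in particular the one defining extensional
equality, so it holds between classes exactly when it holds between representatives. -/
theorem quot_eq_iff {σ : Ty} (a b : h.quot.D σ) : h.quot.Eq a b ↔ a = b := by
  induction a using Quotient.ind with
  | _ a =>
  induction b using Quotient.ind with
  | _ b =>
  have h₁ := h.sat_quot (Fm.eq σ v1 v0) (Env.cons b (Env.cons a Env.nil))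
  rw [quotEnv_cons, quotEnv_cons, Env.eq_nil (h.quotEnv _)] at h₁
  refine h₁.trans ?_
  exact ⟨fun hab => Quotient.sound hab, fun hab => Quotient.exact hab⟩

end Models

end Str

/-- Models of `P` in which extensionally equal objects are equal. -/
class IsModel (M : Str) : Prop where
  models : M.Models
  eq_iff : ∀ {σ : Ty} (a b : M.D σ), M.Eq a b ↔ a = b

/-- Completeness with respect to the models in which extensionally equal objects are equal. -/
theorem proves_of_isModel {T : Set Sentence} {φ : Sentence}
    (h : ∀ M : Str, IsModel M → (∀ ψ ∈ T, M.Sat Env.nil ψ) → M.Sat Env.nil φ) :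
    Proves (P ∪ T) φ := by
  refine proves_of_sat fun M hM => ?_
  have hP : M.Models := Str.models_of_sat fun ψ hψ => hM ψ (Or.inl hψ)
  refine (hP.sat_quot_sentence φ).1 (h hP.quot ⟨?_, hP.quot_eq_iff⟩ fun ψ hψ =>
    (hP.sat_quot_sentence ψ).2 (hM ψ (Or.inr hψ)))
  exact Str.models_of_sat fun ψ hψ => (hP.sat_quot_sentence ψ).2 (hM ψ (Or.inl hψ))

/-! ### Internal formulas -/

namespace Fm

variable {Γ : Ctx}

@[simp] theorem internal_bot : (bot : Fm Γ).Internal := trivial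

@[simp] theorem internal_eqN (t u : Tm Γ Ty.zero) : (Fm.eqN t u).Internal := trivial

@[simp] theorem internal_imp (φ ψ : Fm Γ) :
    (imp φ ψ).Internal ↔ φ.Internal ∧ ψ.Internal := Iff.rfl

@[simp] theorem internal_all {σ : Ty} (φ : Fm (σ :: Γ)) : (all σ φ).Internal ↔ φ.Internal :=
  Iff.rfl

@[simp] theorem internal_neg (φ : Fm Γ) : (neg φ).Internal ↔ φ.Internal := by simp [neg]

@[simp] theorem internal_and (φ ψ : Fm Γ) :
    (Fm.and φ ψ).Internal ↔ φ.Internal ∧ ψ.Internal := by simp [Fm.and]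

@[simp] theorem internal_or (φ ψ : Fm Γ) :
    (Fm.or φ ψ).Internal ↔ φ.Internal ∧ ψ.Internal := by simp [Fm.or]

@[simp] theorem internal_ex {σ : Ty} (φ : Fm (σ :: Γ)) : (ex σ φ).Internal ↔ φ.Internal := by
  simp [ex]

@[simp] theorem internal_le (m n : Tm Γ Ty.zero) : (le m n).Internal := by simp [le]

@[simp] theorem internal_lt (m n : Tm Γ Ty.zero) : (lt m n).Internal := by simp [lt]

@[simp] theorem internal_eq : ∀ {σ : Ty} {Γ : Ctx} (t u : Tm Γ σ), (Fm.eq σ t u).Internal := by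
  intro σ
  induction σ with
  | zero => intros; simp [Fm.eq]
  | arr σ τ _ ih => intros; simp [Fm.eq, ih]
  | seq σ ih => intros; simp [Fm.eq, ih]

@[simp] theorem internal_mem {σ : Ty} (a : Tm Γ σ) (x : Tm Γ (seq σ)) : (mem a x).Internal := by
  simp [mem]

@[simp] theorem internal_rename (φ : Fm Γ) : ∀ {Δ : Ctx} (r : Ren Γ Δ),
    (φ.rename r).Internal ↔ φ.Internal := by
  induction φ with
  | bot => intros; rfl
  | eqN t u => intros; rfl
  | st t => intros; rfl
  | imp φ ψ h₁ h₂ => intros; simp [Fm.rename, h₁, h₂]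
  | all σ φ h => intros; simp [Fm.rename, h]

end Fm

namespace Str

variable {M : Str} {Γ : Ctx}

/-! ### The operations of a model -/

/-- The numbers of a structure. -/
abbrev N (M : Str) : Type := M.D Ty.zero

instance : Zero M.N := ⟨M.con Con.zero⟩
instance : One M.N := ⟨M.app (M.con Con.succ) (M.con Con.zero)⟩
instance : Add M.N := ⟨fun m n => M.app (M.app (M.eval Env.nil addC) m) n⟩
instance : Mul M.N := ⟨fun m n => M.app (M.app (M.eval Env.nil mulC) m) n⟩
instance : LE M.N := ⟨fun m n => ∃ k, m + k = n⟩

/-- The empty sequence. -/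
def nil {σ : Ty} : M.D (seq σ) := M.con (Con.nil σ)

/-- Prepending an element to a sequence. -/
def cons {σ : Ty} (a : M.D σ) (x : M.D (seq σ)) : M.D (seq σ) :=
  M.app (M.app (M.con (Con.cons σ)) a) x

/-- Concatenation. -/
def cat {σ : Ty} (x y : M.D (seq σ)) : M.D (seq σ) :=
  M.app (M.app (M.eval Env.nil (catC σ)) x) y

/-- The initial segments of a type `1` object. -/
def bar (α : M.D Ty.one) (n : M.N) : M.D (seq Ty.zero) :=
  M.app (M.app (M.eval Env.nil barC) α) n

/-- The code of a finite sequence of numbers. -/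
def code (x : M.D (seq Ty.zero)) : M.N := M.app (M.eval Env.nil codeC) x

/-- Primitive recursion. -/
def recN {ρ : Ty} (n : M.N) (y : M.D ρ) (z : M.D (ρ ⇒ Ty.zero ⇒ ρ)) : M.D ρ :=
  M.app (M.app (M.app (M.con (Con.recN ρ)) n) y) z

/-- Recursion over sequences. -/
def recL {σ ρ : Ty} (x : M.D (seq σ)) (y : M.D ρ) (z : M.D (ρ ⇒ σ ⇒ ρ)) : M.D ρ :=
  M.app (M.app (M.app (M.con (Con.recL σ ρ)) x) y) z

section

variable (e : Env M.D Γ)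

@[simp] theorem eval_zer : M.eval e Tm.zer = 0 := rfl

@[simp] theorem eval_add (m n : Tm Γ Ty.zero) :
    M.eval e (Tm.add m n) = M.eval e m + M.eval e n := by
  simp only [Tm.add, eval_app, eval_up]; rfl

@[simp] theorem eval_mul (m n : Tm Γ Ty.zero) :
    M.eval e (Tm.mul m n) = M.eval e m * M.eval e n := by
  simp only [Tm.mul, eval_app, eval_up]; rfl

@[simp] theorem eval_nil {σ : Ty} : M.eval e (Tm.nil : Tm Γ (seq σ)) = nil := rfl

@[simp] theorem eval_cons {σ : Ty} (a : Tm Γ σ) (x : Tm Γ (seq σ)) :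
    M.eval e (Tm.cons a x) = cons (M.eval e a) (M.eval e x) := rfl

@[simp] theorem eval_cat {σ : Ty} (x y : Tm Γ (seq σ)) :
    M.eval e (Tm.cat x y) = cat (M.eval e x) (M.eval e y) := by
  simp only [Tm.cat, eval_app, eval_up]; rfl

@[simp] theorem eval_bar (α : Tm Γ Ty.one) (n : Tm Γ Ty.zero) :
    M.eval e (Tm.bar α n) = bar (M.eval e α) (M.eval e n) := by
  simp only [Tm.bar, eval_app, eval_up]; rfl

@[simp] theorem eval_code (x : Tm Γ (seq Ty.zero)) :
    M.eval e (Tm.code x) = code (M.eval e x) := by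
  simp only [Tm.code, eval_app, eval_up]; rfl

@[simp] theorem app_recN {ρ : Ty} (n : M.N) (y : M.D ρ) (z : M.D (ρ ⇒ Ty.zero ⇒ ρ)) :
    M.app (M.app (M.app (M.con (Con.recN ρ)) n) y) z = recN n y z := rfl

@[simp] theorem app_recL {σ ρ : Ty} (x : M.D (seq σ)) (y : M.D ρ) (z : M.D (ρ ⇒ σ ⇒ ρ)) :
    M.app (M.app (M.app (M.con (Con.recL σ ρ)) x) y) z = recL x y z := rfl

theorem sat_subst_zero (φ : Fm (Ty.zero :: Γ)) :
    M.Sat e (φ.subst (Sub.inst Tm.zer)) ↔ M.Sat (Env.cons 0 e) φ := by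
  rw [sat_subst, Sub.inst_eq_cons]
  have : (fun σ v => M.eval e
      (Env.cons (D := Tm Γ) Tm.zer (fun _ v => Tm.var v) σ v)) = Env.cons (0 : M.N) e := by
    funext σ v; cases v <;> rfl
  rw [this]

end

/-! ### The axioms of arithmetic in a model -/

section

variable [hM : IsModel M] (e : Env M.D Γ)

theorem sat_of_ax {φ : Fm Γ} (h : AxP φ) : M.Sat e φ := hM.models h e

@[simp] theorem sat_eq {σ : Ty} (t u : Tm Γ σ) :
    M.Sat e (Fm.eq σ t u) ↔ M.eval e t = M.eval e u := by
  rw [sat_eq_iff_eq, hM.eq_iff]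

@[simp] theorem sat_eqN (t u : Tm Γ Ty.zero) :
    M.Sat e (Fm.eqN t u) ↔ M.eval e t = M.eval e u :=
  M.sat_eq e t u

theorem fun_ext {σ τ : Ty} {f g : M.D (σ ⇒ τ)} (h : ∀ a, M.app f a = M.app g a) : f = g :=
  (hM.eq_iff _ _).1 ((M.eq_arr_iff _ _).2 fun a => (hM.eq_iff _ _).2 (h a))

@[simp] theorem app_comK {σ τ : Ty} (x : M.D σ) (y : M.D τ) :
    M.app (M.app (M.con (Con.comK σ τ)) x) y = x := by
  simpa using sat_of_ax (Env.cons x (Env.cons y Env.nil)) (AxP.epa (AxEPA.comK σ τ v0 v1))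

@[simp] theorem app_comS {ρ σ τ : Ty} (x : M.D (ρ ⇒ σ ⇒ τ)) (y : M.D (ρ ⇒ σ)) (z : M.D ρ) :
    M.app (M.app (M.app (M.con (Con.comS ρ σ τ)) x) y) z = M.app (M.app x z) (M.app y z) := by
  simpa using sat_of_ax (Env.cons x (Env.cons y (Env.cons z Env.nil)))
    (AxP.epa (AxEPA.comS ρ σ τ v0 v1 v2))

-- Beta conversion, from the equations of the combinators. It allows functionals of the model to be
-- defined by terms.
@[simp] theorem app_lam {σ : Ty} : ∀ {τ : Ty} (t : Tm (σ :: Γ) τ) (a : M.D σ),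
    M.app (M.eval e t.lam) a = M.eval (Env.cons a e) t
  | _, Tm.var Var.here, a => by simp [Tm.lam]
  | _, Tm.var (Var.there v), a => by simp [Tm.lam]
  | _, Tm.con c, a => by simp [Tm.lam]
  | _, Tm.app f b, a => by simp [Tm.lam, app_lam f a, app_lam b a]

@[simp] theorem recN_zero {ρ : Ty} (y : M.D ρ) (z : M.D (ρ ⇒ Ty.zero ⇒ ρ)) : recN 0 y z = y := by
  simpa using sat_of_ax (Env.cons y (Env.cons z Env.nil)) (AxP.epa (AxEPA.rec_zero ρ v0 v1))

theorem recN_succ {ρ : Ty} (n : M.N) (y : M.D ρ) (z : M.D (ρ ⇒ Ty.zero ⇒ ρ)) :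
    recN (M.app (M.con Con.succ) n) y z = M.app (M.app z (recN n y z)) n := by
  simpa [Tm.suc] using sat_of_ax (Env.cons n (Env.cons y (Env.cons z Env.nil)))
    (AxP.epa (AxEPA.rec_succ ρ v0 v1 v2))

@[simp] theorem recL_nil {σ ρ : Ty} (y : M.D ρ) (z : M.D (ρ ⇒ σ ⇒ ρ)) : recL nil y z = y := by
  simpa using sat_of_ax (Env.cons y (Env.cons z Env.nil)) (AxP.epa (AxEPA.recL_nil σ ρ v0 v1))

@[simp] theorem recL_cons {σ ρ : Ty} (a : M.D σ) (x : M.D (seq σ)) (y : M.D ρ)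
    (z : M.D (ρ ⇒ σ ⇒ ρ)) :
    recL (cons a x) y z = M.app (M.app z (recL x y z)) a := by
  simpa using sat_of_ax (Env.cons a (Env.cons x (Env.cons y (Env.cons z Env.nil))))
    (AxP.epa (AxEPA.recL_cons σ ρ v0 v1 v2 v3))

/-- Unfolding a recursive definition leaves its step evaluated in an environment that still carries
the outer arguments. By extensionality it may be exchanged for any step with the same values. -/
theorem recN_congr {ρ : Ty} (n : M.N) (y : M.D ρ) {z z' : M.D (ρ ⇒ Ty.zero ⇒ ρ)}
    (h : ∀ r j, M.app (M.app z r) j = M.app (M.app z' r) j) : recN n y z = recN n y z' := by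
  rw [fun_ext fun r => fun_ext (h r)]

theorem recL_congr {σ ρ : Ty} (x : M.D (seq σ)) (y : M.D ρ) {z z' : M.D (ρ ⇒ σ ⇒ ρ)}
    (h : ∀ r a, M.app (M.app z r) a = M.app (M.app z' r) a) : recL x y z = recL x y z' := by
  rw [fun_ext fun r => fun_ext (h r)]

protected theorem add_zero (m : M.N) : m + 0 = m := by
  change M.app (M.app (M.eval Env.nil addC) m) 0 = m
  simp [addC]

theorem add_succ (m n : M.N) :
    m + M.app (M.con Con.succ) n = M.app (M.con Con.succ) (m + n) := by
  change M.app (M.app (M.eval Env.nil addC) m) _ =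
    M.app (M.con Con.succ) (M.app (M.app (M.eval Env.nil addC) m) n)
  simp only [addC, Tm.suc, app_lam, eval_app, eval_con, eval_var, Env.cons_here, app_recN,
    recN_succ, Env.cons_there]
  exact congrArg _ (recN_congr _ _ fun r j => by simp)

theorem app_succ (n : M.N) : M.app (M.con Con.succ) n = n + 1 := by
  have := add_succ n (0 : M.N)
  rw [Str.add_zero] at this
  exact this.symm

@[simp] theorem eval_suc (t : Tm Γ Ty.zero) : M.eval e t.suc = M.eval e t + 1 := by
  rw [Tm.suc, eval_app, eval_con, app_succ]

@[simp] theorem recN_add_one {ρ : Ty} (n : M.N) (y : M.D ρ) (z : M.D (ρ ⇒ Ty.zero ⇒ ρ)) :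
    recN (n + 1) y z = M.app (M.app z (recN n y z)) n := by
  rw [← app_succ, recN_succ]

protected theorem add_add_one (m n : M.N) : m + (n + 1) = m + n + 1 := by
  simpa [app_succ] using add_succ m n

protected theorem mul_zero (m : M.N) : m * 0 = 0 := by
  change M.app (M.app (M.eval Env.nil mulC) m) 0 = 0
  simp [mulC]

protected theorem mul_add_one (m n : M.N) : m * (n + 1) = m * n + m := by
  change M.app (M.app (M.eval Env.nil mulC) m) (n + 1) =
    M.app (M.app (M.eval Env.nil mulC) m) n + m
  simp only [mulC, app_lam, eval_app, eval_con, eval_var, Env.cons_here, app_recN,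
    recN_add_one, Env.cons_there, eval_add]
  exact congrArg (· + m) (recN_congr _ _ fun r j => by simp)

protected theorem add_one_ne_zero (n : M.N) : n + 1 ≠ 0 := by
  simpa using sat_of_ax (Env.cons n Env.nil) (AxP.epa (AxEPA.succ_ne_zero v0))

protected theorem add_one_inj {m n : M.N} (h : m + 1 = n + 1) : m = n := by
  have := sat_of_ax (Env.cons m (Env.cons n Env.nil)) (AxP.epa (AxEPA.succ_inj v0 v1))
  simp at this
  exact this h

@[simp] theorem sat_le (m n : Tm Γ Ty.zero) :
    M.Sat e (Fm.le m n) ↔ M.eval e m ≤ M.eval e n := by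
  simp [le]; rfl

theorem sat_subst_succ (φ : Fm (Ty.zero :: Γ)) (n : M.N) :
    M.Sat (Env.cons n e) (φ.subst Sub.succ) ↔ M.Sat (Env.cons (n + 1) e) φ := by
  rw [sat_subst]
  have : (fun σ v => M.eval (Env.cons n e) ((Sub.succ : Sub (Ty.zero :: Γ) _) σ v))
      = Env.cons (n + 1) e := by
    funext σ v; cases v <;> simp [Sub.succ, app_succ]
  rw [this]

/-- Induction for predicates that are defined by an internal formula. -/
@[elab_as_elim]
theorem induction {p : M.N → Prop} (φ : Fm (Ty.zero :: Γ)) (e : Env M.D Γ)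
    (hp : ∀ n, M.Sat (Env.cons n e) φ ↔ p n) (hφ : φ.Internal) (h0 : p 0)
    (hs : ∀ n, p n → p (n + 1)) (n : M.N) : p n := by
  have h := sat_of_ax e (AxP.epa (AxEPA.induction φ hφ))
  simp only [sat_imp, sat_and, sat_all, sat_subst_zero, sat_subst_succ, hp] at h
  exact h ⟨h0, hs⟩ n

/-- External induction. -/
@[elab_as_elim]
theorem st_induction {p : M.N → Prop} (φ : Fm (Ty.zero :: Γ)) (e : Env M.D Γ)
    (hp : ∀ n, M.Sat (Env.cons n e) φ ↔ p n) (h0 : p 0)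
    (hs : ∀ n, M.st n → p n → p (n + 1)) (n : M.N) (hn : M.st n) :
    p n := by
  have h := sat_of_ax e (AxP.st_induction φ)
  simp only [sat_imp, sat_and, sat_allSt, sat_subst_zero, sat_subst_succ, hp] at h
  exact h ⟨h0, hs⟩ n hn

/-! ### Arithmetic in a model -/

protected theorem zero_add (n : M.N) : 0 + n = n :=
  induction (Fm.eqN (Tm.add Tm.zer v0) v0) Env.nil (by simp) (by simp) (Str.add_zero 0)
    (fun n h => by rw [Str.add_add_one, h]) n

protected theorem add_one_add (m n : M.N) : m + 1 + n = m + n + 1 :=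
  induction (Fm.eqN (Tm.add (Tm.suc v1) v0) (Tm.suc (Tm.add v1 v0))) (Env.cons m Env.nil)
    (by simp) (by simp) (by rw [Str.add_zero, Str.add_zero])
    (fun n h => by rw [Str.add_add_one, h, Str.add_add_one]) n

protected theorem add_comm (m n : M.N) : m + n = n + m :=
  induction (Fm.eqN (Tm.add v1 v0) (Tm.add v0 v1)) (Env.cons m Env.nil)
    (by simp) (by simp) (by rw [Str.add_zero, Str.zero_add])
    (fun n h => by rw [Str.add_add_one, h, Str.add_one_add]) n

protected theorem add_assoc (k m n : M.N) : k + m + n = k + (m + n) :=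
  induction (Fm.eqN (Tm.add (Tm.add v2 v1) v0) (Tm.add v2 (Tm.add v1 v0)))
    (Env.cons m (Env.cons k Env.nil))
    (by simp) (by simp) (by rw [Str.add_zero, Str.add_zero])
    (fun n h => by rw [Str.add_add_one, h, Str.add_add_one, Str.add_add_one]) n

instance : AddCommMonoid M.N where
  add_assoc := Str.add_assoc
  zero_add := Str.zero_add
  add_zero := Str.add_zero
  add_comm := Str.add_comm
  nsmul := nsmulRec

protected theorem zero_mul (n : M.N) : 0 * n = 0 :=
  induction (Fm.eqN (Tm.mul Tm.zer v0) Tm.zer) Env.nil (by simp) (by simp) (Str.mul_zero 0)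
    (fun n h => by rw [Str.mul_add_one, h, add_zero]) n

protected theorem add_one_mul (m n : M.N) : (m + 1) * n = m * n + n :=
  induction (Fm.eqN (Tm.mul (Tm.suc v1) v0) (Tm.add (Tm.mul v1 v0) v0)) (Env.cons m Env.nil)
    (by simp) (by simp) (by rw [Str.mul_zero, Str.mul_zero, add_zero])
    (fun n h => by rw [Str.mul_add_one, h, Str.mul_add_one]; abel) n

protected theorem mul_comm (m n : M.N) : m * n = n * m :=
  induction (Fm.eqN (Tm.mul v1 v0) (Tm.mul v0 v1)) (Env.cons m Env.nil)
    (by simp) (by simp) (by rw [Str.mul_zero, Str.zero_mul])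
    (fun n h => by rw [Str.mul_add_one, h, Str.add_one_mul]) n

protected theorem mul_add (k m n : M.N) : k * (m + n) = k * m + k * n :=
  induction (Fm.eqN (Tm.mul v2 (Tm.add v1 v0)) (Tm.add (Tm.mul v2 v1) (Tm.mul v2 v0)))
    (Env.cons m (Env.cons k Env.nil))
    (by simp) (by simp) (by rw [add_zero, Str.mul_zero, add_zero])
    (fun n h => by rw [← add_assoc, Str.mul_add_one, h, Str.mul_add_one, add_assoc]) n

protected theorem mul_assoc (k m n : M.N) : k * m * n = k * (m * n) :=
  induction (Fm.eqN (Tm.mul (Tm.mul v2 v1) v0) (Tm.mul v2 (Tm.mul v1 v0)))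
    (Env.cons m (Env.cons k Env.nil))
    (by simp) (by simp) (by rw [Str.mul_zero, Str.mul_zero, Str.mul_zero])
    (fun n h => by rw [Str.mul_add_one, h, Str.mul_add_one, Str.mul_add]) n

protected theorem mul_one (m : M.N) : m * 1 = m := by
  have := Str.mul_add_one m 0
  rwa [zero_add, Str.mul_zero, zero_add] at this

instance : CommSemiring M.N where
  mul_assoc := Str.mul_assoc
  mul_comm := Str.mul_comm
  mul_one := Str.mul_one
  one_mul m := by rw [Str.mul_comm, Str.mul_one]
  zero_mul := Str.zero_mul
  mul_zero := Str.mul_zero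
  left_distrib := Str.mul_add
  right_distrib k m n := by rw [Str.mul_comm, Str.mul_add, Str.mul_comm n k, Str.mul_comm n m]

theorem eq_zero_or_eq_add_one (n : M.N) : n = 0 ∨ ∃ m, n = m + 1 :=
  induction (Fm.or (Fm.eqN v0 Tm.zer) (ex Ty.zero (Fm.eqN v1 (Tm.suc v0)))) Env.nil
    (by simp) (by simp) (Or.inl rfl) (fun n _ => Or.inr ⟨n, rfl⟩) n

theorem add_left_cancel_of_model {k m n : M.N} (h : k + m = k + n) : m = n := by
  have : k + m = k + n → m = n :=
    induction (Fm.imp (Fm.eqN (Tm.add v0 v2) (Tm.add v0 v1)) (Fm.eqN v2 v1))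
      (Env.cons n (Env.cons m Env.nil)) (by simp) (by simp) (by simp)
      (fun k h h' => h (Str.add_one_inj (by
        rwa [add_right_comm, add_right_comm k 1 n] at h'))) k
  exact this h

protected theorem eq_zero_of_add_eq_zero {m n : M.N} (h : m + n = 0) : m = 0 := by
  rcases eq_zero_or_eq_add_one m with rfl | ⟨k, rfl⟩
  · rfl
  · rw [add_right_comm] at h
    exact absurd h (Str.add_one_ne_zero _)

protected theorem le_total (m n : M.N) : m ≤ n ∨ n ≤ m := by
  refine induction (Fm.or (le v0 v1) (le v1 v0)) (Env.cons n Env.nil)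
    (by simp) (by simp) (Or.inl ⟨n, zero_add n⟩) (fun m h => ?_) m
  rcases h with ⟨k, rfl⟩ | ⟨k, rfl⟩
  · rcases eq_zero_or_eq_add_one k with rfl | ⟨k, rfl⟩
    · exact Or.inr ⟨1, by rw [add_zero]⟩
    · exact Or.inl ⟨k, by rw [add_assoc, add_comm 1 k]⟩
  · exact Or.inr ⟨k + 1, (add_assoc _ _ _).symm⟩

noncomputable instance : LinearOrder M.N where
  le_refl m := ⟨0, add_zero m⟩
  le_trans := by
    rintro k m n ⟨a, rfl⟩ ⟨b, rfl⟩
    exact ⟨a + b, (add_assoc _ _ _).symm⟩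
  le_antisymm := by
    rintro m n ⟨a, rfl⟩ ⟨b, h⟩
    have h₁ : a + b = 0 := add_left_cancel_of_model (k := m) (by rw [← add_assoc, h, add_zero])
    rw [Str.eq_zero_of_add_eq_zero h₁, add_zero]
  le_total := Str.le_total
  toDecidableLE := Classical.decRel _

theorem add_one_le_iff {m n : M.N} : m + 1 ≤ n ↔ m < n := by
  constructor
  · rintro ⟨k, rfl⟩
    refine lt_of_le_of_ne ⟨1 + k, (add_assoc _ _ _).symm⟩ fun h => ?_
    have h₁ : k + 1 = 0 := add_left_cancel_of_model (k := m) (by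
      rw [add_zero, ← add_assoc, add_right_comm, ← h])
    exact Str.add_one_ne_zero _ h₁
  · intro h
    obtain ⟨k, rfl⟩ := h.le
    rcases eq_zero_or_eq_add_one k with rfl | ⟨k, rfl⟩
    · exact absurd h (by simp)
    · exact ⟨k, by rw [add_assoc, add_comm 1 k]⟩

theorem lt_add_one_iff {m n : M.N} : m < n + 1 ↔ m ≤ n := by
  rw [← add_one_le_iff]
  constructor
  · rintro ⟨k, h⟩
    exact ⟨k, Str.add_one_inj (by rw [← h, add_right_comm])⟩
  · rintro ⟨k, rfl⟩
    exact ⟨k, by rw [add_right_comm]⟩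

@[simp] theorem sat_lt (m n : Tm Γ Ty.zero) :
    M.Sat e (Fm.lt m n) ↔ M.eval e m < M.eval e n := by
  simp [lt, add_one_le_iff]

protected theorem zero_le (n : M.N) : 0 ≤ n := ⟨n, zero_add n⟩

end

end Str

namespace Str

variable {M : Str} {Γ : Ctx} [hM : IsModel M] {σ : Ty}

/-! ### Finite sequences in a model -/

/-- Once the step no longer depends on `x`, the recursion equations apply directly. The same device
is used for the other operations. -/
theorem len_eq_recL (x : M.D (seq σ)) :
    M.len x = recL x 0 (M.eval Env.nil (Tm.lam (Tm.lam (Tm.suc v1)))) := by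
  simp only [len, lenC, app_lam, eval_app, eval_con, eval_var, Env.cons_here, app_recL, eval_zer]
  exact recL_congr _ _ fun r a => by simp

@[simp] theorem len_nil : M.len (nil : M.D (seq σ)) = 0 := by simp [len_eq_recL]

@[simp] theorem len_cons (a : M.D σ) (x : M.D (seq σ)) : M.len (cons a x) = M.len x + 1 := by
  simp [len_eq_recL]

theorem nth_eq_recL (x : M.D (seq σ)) (i : M.N) :
    M.nth x i = M.app (recL x (M.eval Env.nil (Tm.lam (dflt σ).up)) (M.eval Env.nil
      (Tm.lam (Tm.lam (Tm.lam (Tm.con (Con.recN σ) ⊙ v0 ⊙ v1 ⊙ Tm.lam (Tm.lam (v4 ⊙ v0)))))))) i := by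
  have h : M.eval (Env.cons x Env.nil) (Tm.lam (σ := Ty.zero) (dflt σ).up) =
      M.eval Env.nil (Tm.lam (dflt σ).up) := fun_ext fun a => by simp
  simp only [nth, nthC, app_lam, eval_app, eval_con, eval_var, Env.cons_here, app_recL, h]
  rw [recL_congr]
  intro r a
  refine fun_ext fun i => ?_
  simp only [app_lam, eval_app, eval_con, eval_var, Env.cons_here, Env.cons_there, app_recN]
  exact recN_congr _ _ fun r' j => by simp

@[simp] theorem nth_cons_zero (a : M.D σ) (x : M.D (seq σ)) : M.nth (cons a x) 0 = a := by
  simp [nth_eq_recL]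

@[simp] theorem nth_cons_add_one (a : M.D σ) (x : M.D (seq σ)) (i : M.N) :
    M.nth (cons a x) (i + 1) = M.nth x i := by
  simp [nth_eq_recL]

theorem cat_eq_recL (x y : M.D (seq σ)) :
    cat x y = recL x y (M.eval Env.nil (Tm.lam (Tm.lam (Tm.cons v0 v1)))) := by
  simp only [cat, catC, app_lam, eval_app, eval_con, eval_var, Env.cons_here, Env.cons_there,
    app_recL]
  exact recL_congr _ _ fun r a => by simp

@[simp] theorem nil_cat (y : M.D (seq σ)) : cat nil y = y := by simp [cat_eq_recL]

@[simp] theorem cons_cat (a : M.D σ) (x y : M.D (seq σ)) :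
    cat (cons a x) y = cons a (cat x y) := by
  simp [cat_eq_recL]

theorem code_eq_recL (x : M.D (seq Ty.zero)) :
    code x = recL x 0 (M.eval Env.nil (Tm.lam (Tm.lam
      (Tm.suc (Tm.add (Tm.mul (Tm.add v0 v1) (Tm.add v0 v1)) v0))))) := by
  simp only [code, codeC, app_lam, eval_app, eval_con, eval_var, Env.cons_here,
    app_recL, eval_zer]
  exact recL_congr _ _ fun r a => by simp

@[simp] theorem code_nil : code (nil : M.D (seq Ty.zero)) = 0 := by simp [code_eq_recL]

@[simp] theorem code_cons (a : M.N) (x : M.D (seq Ty.zero)) :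
    code (cons a x) = (a + code x) * (a + code x) + a + 1 := by
  simp [code_eq_recL]

theorem bar_eq_recN (α : M.D Ty.one) (n : M.N) :
    bar α n = recN n nil (M.eval (Env.cons α Env.nil)
      (Tm.lam (Tm.lam (Tm.cat v1 (Tm.cons (v2 ⊙ v0) Tm.nil))))) := by
  simp only [bar, barC, app_lam, eval_app, eval_con, eval_var, Env.cons_here,
    app_recN, eval_nil]
  exact recN_congr _ _ fun r a => by simp

@[simp] theorem bar_zero (α : M.D Ty.one) : bar α 0 = nil := by simp [bar_eq_recN]

@[simp] theorem bar_add_one (α : M.D Ty.one) (n : M.N) :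
    bar α (n + 1) = cat (bar α n) (cons (M.app α n) nil) := by
  simp [bar_eq_recN]

theorem seq_ext {x y : M.D (seq σ)} (h : M.len x = M.len y)
    (h' : ∀ i < M.len x, M.nth x i = M.nth y i) : x = y := by
  refine (hM.eq_iff _ _).1 ((M.eq_seq_iff x y).2 ⟨?_, fun i hi => ?_⟩)
  · exact (M.eq_zero_iff _ _).1 ((hM.eq_iff _ _).2 h)
  · exact (hM.eq_iff _ _).2 (h' i (by simpa using hi))

theorem eq_nil_or_eq_cons (x : M.D (seq σ)) : x = nil ∨ ∃ a y, x = cons a y := by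
  simpa using sat_of_ax (Env.cons x Env.nil) (AxP.epa (AxEPA.seq_cases σ v0))

/-- Induction over sequences, for predicates that are defined by an internal formula. -/
@[elab_as_elim]
theorem seq_induction {p : M.D (seq σ) → Prop} (φ : Fm (seq σ :: Γ)) (e : Env M.D Γ)
    (hp : ∀ x, M.Sat (Env.cons x e) φ ↔ p x) (hφ : φ.Internal) (h0 : p nil)
    (hs : ∀ a x, p x → p (cons a x)) (x : M.D (seq σ)) : p x := by
  -- The axioms give induction over numbers and a case distinction for sequences, so the induction
  -- runs over the length.
  have h : ∀ n : M.N, ∀ x, M.len x = n → p x := by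
    refine fun n => induction (p := fun n => ∀ x, M.len x = n → p x)
      (all (seq σ) (imp (Fm.eqN v0.len v1) (φ.rename Ren.wk.lift))) e (fun n => ?_) (by simpa) ?_
      ?_ n
    · simp only [sat_all, sat_imp, sat_eqN, sat_rename, eval_len, eval_var, Env.cons_here,
        Env.cons_there]
      refine forall_congr' fun x => imp_congr Iff.rfl ?_
      rw [← hp]
      have : (fun τ v => Env.cons x (Env.cons n e) τ
          ((Ren.lift Ren.wk : Ren (seq σ :: Γ) (seq σ :: Ty.zero :: Γ)) τ v)) = Env.cons x e := by
        funext τ v; cases v <;> rfl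
      rw [this]
    · intro x hx
      rcases eq_nil_or_eq_cons x with rfl | ⟨a, y, rfl⟩
      · exact h0
      · rw [len_cons] at hx
        exact absurd hx (Str.add_one_ne_zero _)
    · intro n ih x hx
      rcases eq_nil_or_eq_cons x with rfl | ⟨a, y, rfl⟩
      · exact h0
      · rw [len_cons] at hx
        exact hs a y (ih y (Str.add_one_inj hx))
  exact h _ x rfl

theorem add_one_lt_add_one_iff {m n : M.N} : m + 1 < n + 1 ↔ m < n :=
  lt_add_one_iff.trans add_one_le_iff

theorem not_lt_zero_of_model (n : M.N) : ¬ n < 0 := not_lt.2 (Str.zero_le n)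

theorem len_cat (x y : M.D (seq σ)) : M.len (cat x y) = M.len x + M.len y :=
  seq_induction (Fm.eqN (Tm.len (Tm.cat v0 v1)) (Tm.add v0.len v1.len)) (Env.cons y Env.nil)
    (by simp) (by simp) (by simp)
    (fun a x h => by rw [cons_cat, len_cons, h, len_cons, add_right_comm]) x

theorem nth_cat {x : M.D (seq σ)} (y : M.D (seq σ)) : ∀ i < M.len x,
    M.nth (cat x y) i = M.nth x i := by
  refine seq_induction (all Ty.zero (imp (lt v0 v1.len)
    (Fm.eq σ (Tm.nth (Tm.cat v1 v2) v0) (Tm.nth v1 v0)))) (Env.cons y Env.nil)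
    (by simp) (by simp) ?_ ?_ x
  · intro i hi
    rw [len_nil] at hi
    exact absurd hi (not_lt_zero_of_model i)
  · intro a x ih i hi
    rcases eq_zero_or_eq_add_one i with rfl | ⟨j, rfl⟩
    · simp
    · rw [len_cons, add_one_lt_add_one_iff] at hi
      simpa using ih j hi

theorem nth_cat_len (x : M.D (seq σ)) (a : M.D σ) :
    M.nth (cat x (cons a nil)) (M.len x) = a :=
  seq_induction (Fm.eq σ (Tm.nth (Tm.cat v0 (Tm.cons v1 Tm.nil)) v0.len) v1)
    (Env.cons a Env.nil) (by simp) (by simp) (by simp)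
    (fun b x h => by rw [cons_cat, len_cons, nth_cons_add_one, h]) x

@[simp] theorem len_bar (α : M.D Ty.one) (n : M.N) : M.len (bar α n) = n :=
  induction (Fm.eqN (Tm.len (Tm.bar v1 v0)) v0) (Env.cons α Env.nil) (by simp) (by simp)
    (by simp) (fun n h => by rw [bar_add_one, len_cat, h, len_cons, len_nil, zero_add]) n

theorem nth_bar (α : M.D Ty.one) (n : M.N) : ∀ i < n, M.nth (bar α n) i = M.app α i := by
  refine induction (all Ty.zero (imp (lt v0 v1)
    (Fm.eqN (Tm.nth (Tm.bar v2 v1) v0) (v2 ⊙ v0)))) (Env.cons α Env.nil) (by simp) (by simp)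
    (fun i hi => absurd hi (not_lt_zero_of_model i)) (fun n ih i hi => ?_) n
  rw [bar_add_one]
  rcases (lt_add_one_iff.1 hi).lt_or_eq with h | rfl
  · rw [nth_cat _ _ (by rwa [len_bar]), ih i h]
  · have := nth_cat_len (bar α i) (M.app α i)
    rwa [len_bar] at this

theorem bar_congr {α β : M.D Ty.one} {n : M.N} (h : ∀ i < n, M.app α i = M.app β i) :
    bar α n = bar β n :=
  seq_ext (by simp) fun i hi => by
    rw [len_bar] at hi
    rw [nth_bar _ _ _ hi, nth_bar _ _ _ hi, h i hi]

theorem app_eq_of_bar_eq {α β : M.D Ty.one} {n : M.N} (h : bar α n = bar β n) {i : M.N}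
    (hi : i < n) : M.app α i = M.app β i := by
  rw [← nth_bar α n i hi, h, nth_bar β n i hi]

/-- An initial segment of an initial segment. -/
theorem eq_bar_of_cat_eq_bar {α : M.D Ty.one} {n : M.N} {x y : M.D (seq Ty.zero)}
    (h : cat x y = bar α n) : x = bar α (M.len x) := by
  have hn : M.len x ≤ n := by
    rw [← len_bar α n, ← h, len_cat]
    exact ⟨_, rfl⟩
  refine seq_ext (by simp) fun i hi => ?_
  rw [nth_bar _ _ _ hi, ← nth_cat y i hi, h, nth_bar _ _ _ (hi.trans_le hn)]

/-! ### Coding of sequences -/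

theorem le_mul_self (n : M.N) : n ≤ n * n := by
  rcases eq_zero_or_eq_add_one n with rfl | ⟨m, rfl⟩
  · simp
  · exact ⟨m * m + m, by ring⟩

/-- This bounds the search for an initial segment with a given code, so that the tree of initial
segments has a characteristic function. -/
theorem len_le_code (x : M.D (seq Ty.zero)) : M.len x ≤ code x := by
  refine seq_induction (Fm.le v0.len v0.code) Env.nil (by simp) (by simp) (by simp)
    (fun a x h => ?_) x
  rw [len_cons, code_cons]
  obtain ⟨k, hk⟩ := h
  obtain ⟨l, hl⟩ := le_mul_self (a + code x)
  exact ⟨a + k + l + a, by rw [← hl, ← hk]; ring⟩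

/-- With `s = a + k`, the number `s * s + a` is less than `(s + 1) * (s + 1)`, since `a ≤ s`. It
therefore determines `s`, and then `a`. -/
theorem mul_self_add_lt {a k b l : M.N} (h : a + k < b + l) :
    (a + k) * (a + k) + a < (b + l) * (b + l) + b := by
  obtain ⟨c, hc⟩ := add_one_le_iff.2 h
  rw [← hc]
  -- Here `b + l` is `a + k + 1 + c`; the witness is the difference of the two sides, less one.
  exact add_one_le_iff.1
    ⟨(a + k) * (1 + c) + k + (1 + c) * c + c * (a + k) + c + b, by ring⟩

theorem mul_self_add_inj {a k b l : M.N}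
    (h : (a + k) * (a + k) + a = (b + l) * (b + l) + b) : a = b ∧ k = l := by
  have hs : a + k = b + l := by
    rcases lt_trichotomy (a + k) (b + l) with h' | h' | h'
    · exact absurd h (mul_self_add_lt h').ne
    · exact h'
    · exact absurd h (mul_self_add_lt h').ne'
  rw [hs] at h
  have hab := add_left_cancel_of_model h
  subst hab
  exact ⟨rfl, add_left_cancel_of_model hs⟩

theorem code_injective {x y : M.D (seq Ty.zero)} (h : code x = code y) : x = y := by
  have : ∀ y, code x = code y → x = y := by
    refine seq_induction (all (seq Ty.zero) (imp (Fm.eqN v1.code v0.code)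
      (Fm.eq (seq Ty.zero) v1 v0))) Env.nil (by simp) (by simp) (fun y hy => ?_)
      (fun a x ih y hy => ?_) x
    · rcases eq_nil_or_eq_cons y with rfl | ⟨b, y, rfl⟩
      · rfl
      · rw [code_nil, code_cons] at hy
        exact absurd hy.symm (Str.add_one_ne_zero _)
    · rcases eq_nil_or_eq_cons y with rfl | ⟨b, y, rfl⟩
      · rw [code_nil, code_cons] at hy
        exact absurd hy (Str.add_one_ne_zero _)
      · rw [code_cons, code_cons] at hy
        obtain ⟨rfl, hxy⟩ := mul_self_add_inj (Str.add_one_inj hy)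
        rw [ih y hxy]
  exact this y h

end Str

namespace Str

/-! ### Trees in a model -/

section

variable {M : Str} {Γ : Ctx} {τ : Ty}

/-- The type `1` objects with values at most `1`. -/
def Binary (α : M.D Ty.one) : Prop := ∀ n, M.app α n ≤ 1

/-- Membership of a finite sequence in a set of codes. -/
def InTree (x : M.D (seq Ty.zero)) (T : M.D Ty.one) : Prop := M.app T (code x) = 1

/-- The binary trees of a model. -/
def BinTree [IsModel M] (T : M.D Ty.one) : Prop :=
  Binary T ∧ (∀ c, M.app T c = 1 → ∃ x, code x = c ∧ ∀ i < M.len x, M.nth x i ≤ 1) ∧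
    ∀ x y, InTree (cat x y) T → InTree x T

/-- All binary sequences leave the tree below a given height. -/
def Bounded (T : M.D Ty.one) (k : M.N) : Prop :=
  ∀ β, Binary β → ∃ i ≤ k, ¬ InTree (bar β i) T

theorem not_bounded_of_inTree {α : M.D Ty.one} (hα : Binary α) {T : M.D Ty.one}
    (hT : ∀ n, InTree (bar α n) T) (k : M.N) : ¬ Bounded T k := by
  intro h
  obtain ⟨i, -, hi⟩ := h α hα
  exact hi (hT i)

theorem st_cons {e : Env M.D Γ} {a : M.D τ} (ha : M.st a) (he : ∀ σ v, M.st (e σ v)) :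
    ∀ σ v, M.st (Env.cons a e σ v) := by
  intro σ v
  cases v with
  | here => exact ha
  | there v => exact he σ v

theorem st_nil : ∀ σ v, M.st ((Env.nil : Env M.D []) σ v) := fun _ v => nomatch v

end

variable {M : Str} {Γ : Ctx} [hM : IsModel M] {σ τ : Ty} (e : Env M.D Γ)

@[simp] theorem sat_mem (a : Tm Γ σ) (x : Tm Γ (seq σ)) :
    M.Sat e (mem a x) ↔ ∃ i < M.len (M.eval e x), M.eval e a = M.nth (M.eval e x) i := by
  simp [mem]

theorem zero_ne_one_of_model : (0 : M.N) ≠ 1 := fun h =>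
  Str.add_one_ne_zero (0 : M.N) (by rw [zero_add, h])

theorem le_one_iff {n : M.N} : n ≤ 1 ↔ n = 0 ∨ n = 1 := by
  constructor
  · intro h
    rcases eq_zero_or_eq_add_one n with rfl | ⟨m, rfl⟩
    · exact Or.inl rfl
    · rw [add_one_le_iff, ← zero_add (1 : M.N), lt_add_one_iff] at h
      rw [le_antisymm h (Str.zero_le m), zero_add]
      exact Or.inr rfl
  · rintro (rfl | rfl)
    · exact Str.zero_le _
    · exact le_rfl

@[simp] theorem sat_binary (α : Tm Γ Ty.one) :
    M.Sat e (binary α) ↔ Binary (M.eval e α) := by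
  simp [binary, Binary]

@[simp] theorem sat_inTree (x : Tm Γ (seq Ty.zero)) (T : Tm Γ Ty.one) :
    M.Sat e (inTree x T) ↔ InTree (M.eval e x) (M.eval e T) := by
  simp [inTree, InTree]

@[simp] theorem sat_binTree (T : Tm Γ Ty.one) :
    M.Sat e (binTree T) ↔ BinTree (M.eval e T) := by
  simp [binTree, BinTree, binSeq]

@[simp] theorem sat_bounded (T : Tm Γ Ty.one) (k : Tm Γ Ty.zero) :
    M.Sat e (bounded T k) ↔ Bounded (M.eval e T) (M.eval e k) := by
  simp [bounded, Bounded]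

@[simp] theorem _root_.NSArith.Fm.internal_binary (α : Tm Γ Ty.one) : (binary α).Internal := by
  simp [binary]

@[simp] theorem _root_.NSArith.Fm.internal_inTree (x : Tm Γ (seq Ty.zero)) (T : Tm Γ Ty.one) :
    (inTree x T).Internal := by
  simp [inTree]

@[simp] theorem _root_.NSArith.Fm.internal_binTree (T : Tm Γ Ty.one) : (binTree T).Internal := by
  simp [binTree, binSeq]

@[simp] theorem _root_.NSArith.Fm.internal_bounded (T : Tm Γ Ty.one) (k : Tm Γ Ty.zero) :
    (bounded T k).Internal := by
  simp [bounded]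

/-! ### Characteristic functions of equality and of the tree of initial segments. -/

@[simp] theorem recN_one (y : M.D σ) (z : M.D (σ ⇒ Ty.zero ⇒ σ)) :
    recN 1 y z = M.app (M.app z y) 0 := by
  rw [← zero_add (1 : M.N), recN_add_one, recN_zero]

/-- The recursion step of the characteristic function of equality. -/
def eqTestStep : Tm Γ (Ty.one ⇒ Ty.zero ⇒ Ty.one) :=
  Tm.lam (Tm.lam (Tm.lam (Tm.con (Con.recN Ty.zero) ⊙ v0 ⊙ Tm.zer ⊙ Tm.lam (Tm.lam (v4 ⊙ v0)))))

/-- The characteristic function of equality with zero. -/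
def isZero : Tm Γ Ty.one :=
  Tm.lam (Tm.con (Con.recN Ty.zero) ⊙ v0 ⊙ Tm.suc Tm.zer ⊙ Tm.lam (Tm.lam Tm.zer))

/-- The characteristic function of equality of numbers. -/
def eqTest (m n : Tm Γ Ty.zero) : Tm Γ Ty.zero :=
  Tm.con (Con.recN Ty.one) ⊙ m ⊙ isZero ⊙ eqTestStep ⊙ n

theorem eval_isZero : M.eval e isZero = M.eval Env.nil isZero := by
  refine fun_ext fun n => ?_
  simp only [isZero, app_lam, eval_app, eval_con, eval_var, Env.cons_here, app_recN]
  exact recN_congr _ _ fun r j => by simp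

theorem eval_eqTestStep : M.eval e eqTestStep = M.eval Env.nil eqTestStep := by
  refine fun_ext fun r => fun_ext fun i => fun_ext fun n => ?_
  simp only [eqTestStep, app_lam, eval_app, eval_con, eval_var, Env.cons_here, app_recN]
  exact recN_congr _ _ fun r j => by simp

theorem eval_eqTest (s t : Tm Γ Ty.zero) : M.eval e (eqTest s t)
    = M.app (recN (M.eval e s) (M.eval Env.nil isZero) (M.eval Env.nil eqTestStep))
        (M.eval e t) := by
  simp only [eqTest, eval_app, eval_con, app_recN, eval_isZero e, eval_eqTestStep e]

/-- The recursion on `m` yields a function of `n`: the test for `m + 1` fails at `0` and at `n + 1`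
repeats the test for `m` at `n`. Hence `n` stays quantified in the induction. -/
theorem eqTest_spec (m n : M.N) :
    (m = n → M.app (recN m (M.eval Env.nil isZero) (M.eval Env.nil eqTestStep)) n = 1) ∧
    (m ≠ n → M.app (recN m (M.eval Env.nil isZero) (M.eval Env.nil eqTestStep)) n = 0) := by
  refine induction (p := fun m => ∀ n,
      (m = n → M.app (recN m (M.eval Env.nil isZero) (M.eval Env.nil eqTestStep)) n = 1) ∧
      (m ≠ n → M.app (recN m (M.eval Env.nil isZero) (M.eval Env.nil eqTestStep)) n = 0))
    (all Ty.zero (Fm.and (imp (Fm.eqN v1 v0) (Fm.eqN (eqTest v1 v0) (Tm.suc Tm.zer)))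
      (imp (neg (Fm.eqN v1 v0)) (Fm.eqN (eqTest v1 v0) Tm.zer)))) Env.nil
    (fun m => by simp [eval_eqTest]) (by simp) (fun n => ?_) (fun m ih n => ?_) m n
  · rw [recN_zero]
    rcases eq_zero_or_eq_add_one n with rfl | ⟨n, rfl⟩
    · simp [isZero]
    · simp [isZero, (Str.add_one_ne_zero n).symm]
  · rw [recN_add_one]
    rcases eq_zero_or_eq_add_one n with rfl | ⟨n, rfl⟩
    · simp [eqTestStep, Str.add_one_ne_zero m]
    · have h : m + 1 = n + 1 ↔ m = n := ⟨Str.add_one_inj, fun h => by rw [h]⟩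
      simpa [eqTestStep, h] using ih n

/-- A bounded search for an initial segment of `α` with code `c`. -/
def segStep : Tm (Ty.zero :: Ty.one :: Γ) (Ty.zero ⇒ Ty.zero ⇒ Ty.zero) :=
  Tm.lam (Tm.lam (Tm.con (Con.recN Ty.zero) ⊙ eqTest (Tm.code (Tm.bar v3 v0)) v2 ⊙ v1 ⊙
    Tm.lam (Tm.lam (Tm.suc Tm.zer))))

theorem app_segStep (c r n : M.N) (α : M.D Ty.one) :
    (code (bar α n) = c → M.app (M.app (M.eval (Env.cons c (Env.cons α e)) segStep) r) n = 1) ∧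
    (code (bar α n) ≠ c → M.app (M.app (M.eval (Env.cons c (Env.cons α e)) segStep) r) n = r) := by
  obtain ⟨h₁, h₂⟩ := eqTest_spec (code (bar α n)) c
  refine ⟨fun h => ?_, fun h => ?_⟩
  · have h₃ := h₁ h
    simp [segStep, eval_eqTest, h₃]
  · simp [segStep, eval_eqTest, h₂ h]

theorem recN_segStep (c : M.N) (α : M.D Ty.one) (m : M.N) :
    recN m 0 (M.eval (Env.cons c (Env.cons α Env.nil)) segStep) ≤ 1 ∧
    (recN m 0 (M.eval (Env.cons c (Env.cons α Env.nil)) segStep) = 1 ↔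
      ∃ n < m, code (bar α n) = c) := by
  set z := M.eval (Env.cons c (Env.cons α Env.nil)) segStep with hz
  refine induction (p := fun m => recN m 0 z ≤ 1 ∧ (recN m 0 z = 1 ↔ ∃ n < m, code (bar α n) = c))
    (Fm.and (le (Tm.con (Con.recN Ty.zero) ⊙ v0 ⊙ Tm.zer ⊙ v1) (Tm.suc Tm.zer))
      (Fm.iff (Fm.eqN (Tm.con (Con.recN Ty.zero) ⊙ v0 ⊙ Tm.zer ⊙ v1) (Tm.suc Tm.zer))
        (ex Ty.zero (Fm.and (lt v0 v1) (Fm.eqN (Tm.code (Tm.bar v4 v0)) v3)))))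
    (Env.cons z (Env.cons c (Env.cons α Env.nil))) (fun m => by simp) (by simp [Fm.iff]) ?_
    (fun m ih => ?_) m
  · rw [recN_zero]
    exact ⟨Str.zero_le _, fun h => absurd h zero_ne_one_of_model,
      fun ⟨n, hn, _⟩ => absurd hn (not_lt_zero_of_model n)⟩
  · rw [recN_add_one]
    obtain ⟨h₁, h₂⟩ := app_segStep Env.nil c (recN m 0 z) m α
    rw [← hz] at h₁ h₂
    by_cases hc : code (bar α m) = c
    · rw [h₁ hc]
      exact ⟨le_rfl, fun _ => ⟨m, lt_add_one_iff.2 le_rfl, hc⟩, fun _ => rfl⟩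
    · rw [h₂ hc, ih.2]
      refine ⟨ih.1, fun ⟨n, hn, h⟩ => ⟨n, lt_add_one_iff.2 hn.le, h⟩, fun ⟨n, hn, h⟩ => ?_⟩
      rcases (lt_add_one_iff.1 hn).lt_or_eq with hn | rfl
      · exact ⟨n, hn, h⟩
      · exact absurd h hc

/-- The tree of the initial segments of a binary sequence. -/
theorem exists_binTree {α : M.D Ty.one} (hα : Binary α) :
    ∃ T, BinTree T ∧ ∀ x, InTree x T ↔ ∃ n, x = bar α n := by
  -- A segment of length `n` has code at least `n`, so a search through all `n < c + 1` finds every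
  -- segment with code `c`.
  let T : M.D Ty.one := M.eval (Env.cons α Env.nil)
    (Tm.lam (Tm.con (Con.recN Ty.zero) ⊙ Tm.suc v0 ⊙ Tm.zer ⊙ segStep))
  have hT : ∀ c, M.app T c = recN (c + 1) 0 (M.eval (Env.cons c (Env.cons α Env.nil)) segStep) :=
    fun c => by simp only [T, app_lam, eval_app, eval_con, eval_suc, eval_var, Env.cons_here,
      eval_zer, app_recN]
  have hx : ∀ x, InTree x T ↔ ∃ n, x = bar α n := by
    intro x
    rw [InTree, hT, (recN_segStep _ _ _).2]
    constructor
    · rintro ⟨n, -, h⟩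
      exact ⟨n, (code_injective h).symm⟩
    · rintro ⟨n, rfl⟩
      refine ⟨n, lt_add_one_iff.2 ?_, rfl⟩
      simpa using len_le_code (bar α n)
  refine ⟨T, ⟨fun c => ?_, fun c hc => ?_, fun x y hxy => ?_⟩, hx⟩
  · rw [hT]
    exact (recN_segStep _ _ _).1
  · rw [hT, (recN_segStep _ _ _).2] at hc
    obtain ⟨n, -, h⟩ := hc
    refine ⟨_, h, fun i hi => ?_⟩
    rw [len_bar] at hi
    rw [nth_bar _ _ _ hi]
    exact hα i
  · obtain ⟨n, hn⟩ := (hx _).1 hxy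
    exact (hx _).2 ⟨_, eq_bar_of_cat_eq_bar hn⟩

/-! ### Standard objects -/

theorem st_closed (t : Tm [] σ) : M.st (M.eval Env.nil t) :=
  sat_of_ax Env.nil (AxP.st_closed t)

theorem st_app {f : M.D (σ ⇒ τ)} {a : M.D σ} (hf : M.st f) (ha : M.st a) : M.st (M.app f a) := by
  have h := sat_of_ax (Env.cons f (Env.cons a Env.nil)) (AxP.st_app σ τ v0 v1)
  simp only [sat_imp, sat_and] at h
  exact h ⟨hf, ha⟩

theorem st_eval {e : Env M.D Γ} (he : ∀ σ v, M.st (e σ v)) (t : Tm Γ σ) : M.st (M.eval e t) := by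
  induction t with
  | var v => exact he _ v
  | con c => exact st_closed (Tm.con c)
  | app f a hf ha => exact st_app hf ha

theorem st_add_one {n : M.N} (hn : M.st n) : M.st (n + 1) := by
  rw [← app_succ]
  exact st_app (st_closed (Tm.con Con.succ)) hn

/-- The predicate "all `m ≤ n` are standard" is not internal, but external induction applies to it.
-/
theorem st_of_le {m n : M.N} (hn : M.st n) (hmn : m ≤ n) : M.st m := by
  have : ∀ m ≤ n, M.st m := by
    refine st_induction (p := fun n => ∀ m ≤ n, M.st m)
      (all Ty.zero (imp (le v0 v1) (Fm.st v0))) Env.nil (by simp) (fun m hm => ?_)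
      (fun n hn ih m hm => ?_) n hn
    · rw [le_antisymm hm (Str.zero_le m)]
      exact st_closed Tm.zer
    · rcases hm.lt_or_eq with h | rfl
      · exact ih m (lt_add_one_iff.1 h)
      · exact st_add_one hn
  exact this m hmn

/-- The length of a standard sequence is standard, hence so is every index below it. -/
theorem st_nth {x : M.D (seq σ)} (hx : M.st x) {i : M.N} (hi : i < M.len x) :
    M.st (M.nth x i) :=
  st_app (st_app (st_closed _) hx) (st_of_le (st_app (st_closed _) hx) hi.le)

/-- The herbrandized axiom of choice in a model. -/
theorem exists_st_choice {p : M.D σ → M.D τ → Prop} (φ : Fm (τ :: σ :: Γ)) (e : Env M.D Γ)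
    (hp : ∀ x y, M.Sat (Env.cons y (Env.cons x e)) φ ↔ p x y) (hφ : φ.Internal)
    (h : ∀ x, M.st x → ∃ y, M.st y ∧ p x y) :
    ∃ F : M.D (σ ⇒ seq τ), M.st F ∧ ∀ x, M.st x →
      ∃ i < M.len (M.app F x), p x (M.nth (M.app F x) i) := by
  have h' := sat_of_ax e (AxP.hac σ τ φ hφ)
  simp only [sat_imp, sat_allSt, sat_exSt, hp] at h'
  obtain ⟨F, hF, H⟩ := h' h
  refine ⟨F, hF, fun x hx => ?_⟩
  have H := H x hx
  simp only [sat_ex, sat_and, sat_mem, sat_rename] at H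
  obtain ⟨y, ⟨i, hi, hy⟩, H⟩ := H
  refine ⟨i, hi, ?_⟩
  change y = M.nth (M.app F x) i at hy
  rw [← hy, ← hp]
  convert H using 1
  funext ρ v
  rcases v with _ | v
  · rfl
  · rcases v with _ | v <;> rfl

/-- Idealisation in a model. -/
theorem idealisation {p : M.D σ → M.D τ → Prop} (φ : Fm (σ :: τ :: Γ)) (e : Env M.D Γ)
    (hp : ∀ z y, M.Sat (Env.cons z (Env.cons y e)) φ ↔ p z y) (hφ : φ.Internal)
    (h : ∀ x : M.D (seq σ), M.st x → ∃ y, ∀ i < M.len x, p (M.nth x i) y) :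
    ∃ y, ∀ z, M.st z → p z y := by
  have h' := sat_of_ax e (AxP.idealisation σ τ φ hφ)
  simp only [sat_imp, sat_allSt, sat_ex, hp] at h'
  refine h' fun x hx => ?_
  obtain ⟨y, hy⟩ := h x hx
  refine ⟨y, fun z hz => ?_⟩
  rw [sat_mem] at hz
  obtain ⟨i, hi, hz⟩ := hz
  change z = M.nth x i at hz
  subst hz
  have := (hp _ _).2 (hy i hi)
  rw [sat_rename]
  convert this using 1
  funext ρ v
  rcases v with _ | v
  · rfl
  · rcases v with _ | v <;> rfl

/-! ### Standard parts and the special fan functional -/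

/-- The sum of a sequence of numbers. -/
def sumC : Tm [] (seq Ty.zero ⇒ Ty.zero) :=
  Tm.lam (Tm.con (Con.recL Ty.zero Ty.zero) ⊙ v0 ⊙ Tm.zer ⊙ Tm.lam (Tm.lam (Tm.add v1 v0)))

theorem app_sumC (x : M.D (seq Ty.zero)) : M.app (M.eval Env.nil sumC) x =
    recL x 0 (M.eval Env.nil (Tm.lam (Tm.lam (Tm.add v1 v0)))) := by
  simp only [sumC, app_lam, eval_app, eval_con, eval_var, Env.cons_here, app_recL, eval_zer]
  exact recL_congr _ _ fun r a => by simp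

/-- The sum replaces the maximum as an upper bound, given by a closed term, of finitely many
numbers. -/
theorem nth_le_sum (x : M.D (seq Ty.zero)) :
    ∀ i < M.len x, M.nth x i ≤ M.app (M.eval Env.nil sumC) x := by
  refine seq_induction (all Ty.zero (imp (lt v0 v1.len) (le (v1.nth v0) (sumC.up ⊙ v1))))
    Env.nil (by simp) (by simp) (fun i hi => ?_) (fun a x ih i hi => ?_) x
  · rw [len_nil] at hi
    exact absurd hi (not_lt_zero_of_model i)
  · have hs : M.app (M.eval Env.nil sumC) (cons a x) = M.app (M.eval Env.nil sumC) x + a := by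
      simp [app_sumC]
    rw [hs]
    rcases eq_zero_or_eq_add_one i with rfl | ⟨j, rfl⟩
    · rw [nth_cons_zero]
      exact ⟨_, add_comm _ _⟩
    · rw [len_cons, add_one_lt_add_one_iff] at hi
      rw [nth_cons_add_one]
      exact (ih j hi).trans ⟨a, rfl⟩

/-- A binary sequence with values at most `1` at the places where `β` has these values. -/
def clip : Tm (Ty.one :: Γ) Ty.one :=
  Tm.lam (Tm.con (Con.recN Ty.zero) ⊙ (v1 ⊙ v0) ⊙ Tm.zer ⊙ Tm.lam (Tm.lam (Tm.suc Tm.zer)))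

theorem binary_clip (β : M.D Ty.one) : Binary (M.eval (Env.cons β Env.nil) clip) := by
  intro n
  rcases eq_zero_or_eq_add_one (M.app β n) with h | ⟨m, h⟩ <;> simp [clip, h, Str.zero_le]

theorem app_clip {β : M.D Ty.one} {n : M.N} (h : M.app β n ≤ 1) :
    M.app (M.eval (Env.cons β Env.nil) clip) n = M.app β n := by
  rcases le_one_iff.1 h with h | h
  · simp [clip, h]
  · simp [clip, h]

/-- `α` agrees with a standard binary sequence at all standard arguments. -/
def HasStandardPart (α : M.D Ty.one) : Prop :=
  ∃ β, M.st β ∧ Binary β ∧ ∀ n, M.st n → M.app α n = M.app β n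

/-- A standard functional that separates a binary sequence from all standard sequences. -/
theorem exists_st_separating {α : M.D Ty.one} (hα : Binary α) (h : ¬ HasStandardPart α) :
    ∃ g : M.D Ty.two, M.st g ∧ ∀ β, M.st β → ∃ n < M.app g β, M.app α n ≠ M.app β n := by
  have h₁ : ∀ β, M.st β → ∃ n, M.st n ∧ M.app α n ≠ M.app β n := by
    intro β hβ
    by_contra! hc
    -- At nonstandard arguments `β` need not be binary. Its clipping is binary everywhere and is
    -- unchanged where `β` agrees with `α`.
    refine h ⟨M.eval (Env.cons β Env.nil) clip, st_eval (st_cons hβ st_nil) _, binary_clip β,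
      fun n hn => ?_⟩
    have hn := hc n hn
    rw [app_clip (by rw [← hn]; exact hα n), hn]
  -- Choice is used with the possibly nonstandard parameter `α`, which is allowed because the
  -- formula is internal.
  obtain ⟨F, hF, H⟩ := exists_st_choice (p := fun β n => M.app α n ≠ M.app β n)
    (neg (Fm.eqN (v2 ⊙ v0) (v1 ⊙ v0))) (Env.cons α Env.nil) (by simp) (by simp) h₁
  -- The sum of the candidates in `F(β)` bounds the right one, and the successor makes the bound
  -- strict.
  refine ⟨M.eval (Env.cons F Env.nil) (Tm.lam (Tm.suc (sumC.up ⊙ (v1 ⊙ v0)))),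
    st_eval (st_cons hF st_nil) _, fun β hβ => ?_⟩
  obtain ⟨i, hi, hn⟩ := H β hβ
  refine ⟨_, ?_, hn⟩
  simpa [lt_add_one_iff] using nth_le_sum _ i hi

/-- The standard objects satisfy the normal form. -/
def NormalForm (M : Str) [IsModel M] : Prop :=
  ∀ g : M.D Ty.two, M.st g → ∃ w : M.D (seq Ty.one), M.st w ∧ ∀ T, BinTree T →
    ∃ α k, Binary α ∧ (∃ γ, (∃ i < M.len w, γ = M.nth w i) ∧ M.app γ 0 = k ∧
      ∀ n, M.app γ (n + 1) = M.app α n) ∧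
      (¬ InTree (bar α (M.app g α)) T → Bounded T k)

theorem sat_STP : M.Sat Env.nil STP ↔ ∀ α : M.D Ty.one, Binary α → HasStandardPart α := by
  simp [STP, approx, HasStandardPart]

theorem sat_normalForm : M.Sat Env.nil normalForm ↔ NormalForm M := by
  simp [normalForm, pairMem, NormalForm]

theorem sat_existsStandardSCF : M.Sat Env.nil existsStandardSCF ↔
    ∃ Θ₁ : M.D (Ty.two ⇒ Ty.zero), M.st Θ₁ ∧ ∃ Θ₂ : M.D (Ty.two ⇒ seq Ty.one), M.st Θ₂ ∧
      ∀ g T, BinTree T → (∀ α, (∃ i < M.len (M.app Θ₂ g), α = M.nth (M.app Θ₂ g) i) →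
        ¬ InTree (bar α (M.app g α)) T) → Bounded T (M.app Θ₁ g) := by
  simp [existsStandardSCF, SCF]

/-- The tree of initial segments of `α` is unbounded, while the sequence offered by the normal form
is standard and so leaves this tree at the height prescribed by the separating `g`. -/
theorem hasStandardPart_of_normalForm (h : NormalForm M) {α : M.D Ty.one} (hα : Binary α) :
    HasStandardPart α := by
  by_contra hc
  obtain ⟨g, hg, hsep⟩ := exists_st_separating hα hc
  obtain ⟨T, hT, hin⟩ := exists_binTree hα
  obtain ⟨w, hw, H⟩ := h g hg
  obtain ⟨β, k, -, ⟨γ, ⟨i, hi, rfl⟩, -, hγ⟩, H⟩ := H T hT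
  have hβ : M.st β := by
    -- `β` is the tail of an entry of the standard sequence `w`, obtained from that entry by a term.
    have : β = M.eval (Env.cons (M.nth w i) Env.nil) (Tm.lam (v1 ⊙ Tm.suc v0)) :=
      fun_ext fun n => by simp [hγ]
    rw [this]
    exact st_eval (st_cons (st_nth hw hi) st_nil) _
  refine not_bounded_of_inTree hα (fun n => (hin _).2 ⟨n, rfl⟩) k (H fun hb => ?_)
  obtain ⟨n, hn, hne⟩ := hsep β hβ
  obtain ⟨m, hm⟩ := (hin _).1 hb
  -- The segment of `β` equals some segment of `α`; comparing lengths shows that it is the one of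
  -- length `g(β)`.
  have hlen := congrArg M.len hm
  rw [len_bar, len_bar] at hlen
  subst hlen
  exact hne (app_eq_of_bar_eq hm hn).symm

/-- All entries of `Θ₂(g)` are standard, because `Θ₂` and `g` are. Hence they all leave the tree of
`α`, which would then be bounded although `α` is a path. -/
theorem hasStandardPart_of_specialFan {Θ₁ : M.D (Ty.two ⇒ Ty.zero)}
    {Θ₂ : M.D (Ty.two ⇒ seq Ty.one)} (hΘ₂ : M.st Θ₂)
    (h : ∀ g T, BinTree T → (∀ α, (∃ i < M.len (M.app Θ₂ g), α = M.nth (M.app Θ₂ g) i) →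
        ¬ InTree (bar α (M.app g α)) T) → Bounded T (M.app Θ₁ g))
    {α : M.D Ty.one} (hα : Binary α) : HasStandardPart α := by
  by_contra hc
  obtain ⟨g, hg, hsep⟩ := exists_st_separating hα hc
  obtain ⟨T, hT, hin⟩ := exists_binTree hα
  refine not_bounded_of_inTree hα (fun n => (hin _).2 ⟨n, rfl⟩) _ (h g T hT ?_)
  rintro β ⟨i, hi, rfl⟩ hb
  obtain ⟨n, hn, hne⟩ := hsep _ (st_nth (st_app hΘ₂ hg) hi)
  obtain ⟨m, hm⟩ := (hin _).1 hb
  have hlen := congrArg M.len hm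
  rw [len_bar, len_bar] at hlen
  subst hlen
  exact hne (app_eq_of_bar_eq hm hn).symm

/-- A tree with binary sequences of all standard lengths has a standard sequence in it, up to
any standard height that depends on the sequence. -/
theorem exists_st_bar_inTree (h : ∀ α : M.D Ty.one, Binary α → HasStandardPart α)
    {g : M.D Ty.two} (hg : M.st g) {T : M.D Ty.one} (hT : ∀ k, M.st k → ¬ Bounded T k) :
    ∃ α, M.st α ∧ Binary α ∧ InTree (bar α (M.app g α)) T := by
  obtain ⟨β, hβ⟩ := idealisation (p := fun k β => Binary β ∧ InTree (bar β k) T)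
    (Fm.and (binary v1) (inTree (Tm.bar v1 v0) v2)) (Env.cons T Env.nil) (by simp) (by simp)
    fun x hx => by
      -- For finitely many heights, a sequence that stays in `T` up to their sum serves all of them.
      have := hT _ (st_app (st_closed sumC) hx)
      simp only [Bounded, not_forall, not_exists, not_and, not_not] at this
      obtain ⟨β, hβ, hin⟩ := this
      exact ⟨β, fun i hi => ⟨hβ, hin _ (nth_le_sum x i hi)⟩⟩
  obtain ⟨α, hα, hbin, hαβ⟩ := h β (hβ 0 (st_closed Tm.zer)).1
  have hgα := st_app hg hα
  refine ⟨α, hα, hbin, ?_⟩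
  -- Everything below the standard number `g(α)` is standard, so the two sequences have the same
  -- segment of this length.
  rw [← bar_congr fun i hi => hαβ i (st_of_le hgα (le_of_lt hi))]
  exact (hβ _ hgα).2

/-- The failure of every standard `w` is the premise of idealisation: each standard finite list of
pairs is refuted by some tree. The conclusion is one tree that refutes all standard pairs. -/
theorem normalForm_of_hasStandardPart (h : ∀ α : M.D Ty.one, Binary α → HasStandardPart α) :
    NormalForm M := by
  intro g hg
  by_contra hc
  -- The pair is decoded inside the formula: `tl` is the sequence coded by `γ`, and the value of `γ`
  -- at `0` is the number.
  let tl : Tm [Ty.one, Ty.one, Ty.two] Ty.one := Tm.lam (v1 ⊙ Tm.suc v0)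
  obtain ⟨T, hT⟩ := idealisation (p := fun γ T => BinTree T ∧
      ¬ (Binary (M.eval (Env.cons γ (Env.cons T (Env.cons g Env.nil))) tl) ∧
        (¬ InTree (bar (M.eval (Env.cons γ (Env.cons T (Env.cons g Env.nil))) tl)
          (M.app g (M.eval (Env.cons γ (Env.cons T (Env.cons g Env.nil))) tl))) T →
          Bounded T (M.app γ 0))))
    (Fm.and (binTree v1) (neg (Fm.and (binary tl)
      (imp (neg (inTree (Tm.bar tl (v2 ⊙ tl)) v1)) (bounded v1 (v0 ⊙ Tm.zer))))))
    (Env.cons g Env.nil) (by simp) (by simp) fun w hw => by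
      by_contra! hw'
      refine hc ⟨w, hw, fun T hT => ?_⟩
      obtain ⟨i, hi, H⟩ := hw' T
      obtain ⟨H₁, H₂⟩ := H hT
      exact ⟨_, _, H₁, ⟨M.nth w i, ⟨i, hi, rfl⟩, rfl, fun n => by simp [tl]⟩, H₂⟩
  have key : ∀ α, M.st α → Binary α → ∀ k, M.st k →
      ¬ InTree (bar α (M.app g α)) T ∧ ¬ Bounded T k := by
    intro α hα hbin k hk
    -- The code of `(α, k)`, given by a term in the standard parameters `α` and `k`, hence standard.
    let γ : M.D Ty.one := M.eval (Env.cons α (Env.cons k Env.nil))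
      (Tm.lam (Tm.con (Con.recN Ty.zero) ⊙ v0 ⊙ v2 ⊙ Tm.lam (Tm.lam (v3 ⊙ v0))))
    have h0 : M.app γ 0 = k := by simp [γ]
    have htl : M.eval (Env.cons γ (Env.cons T (Env.cons g Env.nil))) tl = α :=
      fun_ext fun n => by simp [tl, γ]
    have H := (hT γ (st_eval (st_cons hα (st_cons hk st_nil)) _)).2
    rw [htl, h0] at H
    simp only [not_and, Classical.not_imp] at H
    exact H hbin
  have hzero : M.st (0 : M.N) := st_closed Tm.zer
  -- To read off that `T` is unbounded, `key` needs some standard binary sequence; the zero sequence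
  -- will do.
  have hconst : Binary (M.eval Env.nil (Tm.lam Tm.zer)) := fun n => by simp [Str.zero_le]
  obtain ⟨α, hα, hbin, hin⟩ := exists_st_bar_inTree h hg fun k hk =>
    (key _ (st_closed (Tm.lam Tm.zer)) hconst k hk).2
  exact (key α hα hbin 0 hzero).1 hin

end Str

end NSArith

theorem theorem4p4 :
    NSArith.Proves NSArith.P (NSArith.Fm.iff NSArith.STP NSArith.normalForm) ∧
    NSArith.Proves (NSArith.P ∪ {NSArith.existsStandardSCF}) NSArith.STP := by
  constructor
  · rw [← Set.union_empty NSArith.P]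
    refine NSArith.proves_of_isModel fun M _ _ => ?_
    rw [NSArith.Str.sat_iff, NSArith.Str.sat_STP, NSArith.Str.sat_normalForm]
    exact ⟨NSArith.Str.normalForm_of_hasStandardPart,
      fun h _ => NSArith.Str.hasStandardPart_of_normalForm h⟩
  · refine NSArith.proves_of_isModel fun M _ h => ?_
    obtain ⟨_, _, _, hΘ₂, h⟩ := NSArith.Str.sat_existsStandardSCF.1 (h _ rfl)
    exact NSArith.Str.sat_STP.2 fun _ => NSArith.Str.hasStandardPart_of_specialFan hΘ₂ h
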